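/- **Proposition (local convergence of the Frank–Wolfe method with in face directions, FDFW).** Let $G=(V,E)$ be a finite graph, let $\bar E$ be the edge set of its complement, let $s\in\mathbb N$ with $0\le s\le|\bar E|$, and let $\alpha\in(0,2)$, $\beta>0$. Put $$D_s(G)=\Big\{y\in\{0,1\}^{\bar E}:\sum_e y_e\le s\Big\},\quad D'_s(G)=\Big\{y\in[0,1]^{\bar E}:\sum_e y_e\le s\Big\},\quad \mathcal P=\Delta\times D'_s(G),$$ where $\Delta=\{x\in\mathbb R^V_{\ge0}:\sum_i x_i=1\}$. Let $A_G$ be the adjacency matrix of $G$, let $A(y)_{ij}=y_{ij}$ if $\{i,j\}\in\bar E$ and $A(y)_{ij}=0$ otherwise, and consider the problem $$\max_{(x,y)\in\mathcal P} h(x,y),\qquad h(x,y)=x^{\top}[A_G+A(y)]x+\tfrac{\alpha}{2}\|x\|^2+\tfrac{\beta}{2}\|y\|^2 .$$ For $y\in D_s(G)$ let $G(y)$ be $G$ with the edges $\{i,j\}$ such that $y_{ij}=1$ added; for nonempty $C\subseteq V$ let $x^{(C)}=\frac1{|C|}\sum_{i\in C}e_i$. *FDFW.* For $z\in\mathcal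 P$ let $\mathcal F(z)$ be the minimal face of $\mathcal P$ containing $z$. Start from any $z_0\in\mathcal P$. At step $k$, if $z_k$ is stationary, i.e. $\langle\nabla h(z_k),v-z_k\rangle\le0$ for all $v\in\mathcal P$, then stop; in this case put $z_j=z_k$ for all $j\ge k$. Otherwise choose $s_k\in\arg\max_{v\in\mathcal P}\langle\nabla h(z_k),v\rangle$ and $v_k\in\arg\min_{v\in\mathcal F(z_k)}\langle\nabla h(z_k),v\rangle$, put $d_k=s_k-z_k$ if $\langle\nabla h(z_k),s_k-z_k\rangle\ge\langle\nabla h(z_k),z_k-v_k\rangle$ and $d_k=z_k-v_k$ otherwise, choose $\alpha_k\in(0,\alpha_k^{\max}]$, where $\alpha_k^{\max}=\max\{a\ge0: z_k+a\,d_k\in\mathcal P\}$, and put $z_{k+1}=z_k+\alpha_kd_k$. For $c,\rho>0$ consider the following conditions, required at all steps that are performed: $$\text{(S1)}\quad \alpha_k\ge\bar\alpha_k:=\min\Big(\alpha_k^{\max},\,c\,\frac{\langle\nabla h(z_k),d_k\rangle}{\|d_k\|^2}\Big),\qquad \text{(S2)}\quad h(z_k+\alpha_kd_k)-h(z_k)\ge\rho\,\bar\alpha_k\,\langle\nabla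 h(z_k),d_k\rangle .$$ *Claim.* Let $p$ be a strict local maximizer of $h$ on $\mathcal P$. Then $p=(x^{(C)},y^{(p)})$ with $y^{(p)}\in D_s(G)$ and $C$ a nonempty maximal clique of $G(y^{(p)})$, and for every $c>0$ there is a neighbourhood $U$ of $p$ such that for every sequence $z_k=(x_k,y_k)$ generated by FDFW that satisfies (S1) with the constant $c$ and enters $U$, with $\bar k:=\min\{k\in\mathbb N_0: z_k\in U\}$: (a) if $h(z_k)$ is monotonically nondecreasing in $k$, then $\operatorname{supp}(x_k)=C$ and $y_k=y^{(p)}$ for every $k\ge\bar k+\dim\mathcal F(z_{\bar k})$; (b) if (S2) also holds, with the same $c$ and some $\rho>0$, then $z_k\to p$. -/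

import Mathlib

open scoped Topology

/-! ### The Frank-Wolfe method with in face directions, for maximizing `f` over `Q` -/

namespace FDFW

section

variable {E : Type*} [NormedAddCommGroup E] [InnerProductSpace ℝ E] [CompleteSpace E]

/-- The minimal face of the convex set `Q` containing `w`: the intersection of all faces
(convex extreme subsets) of `Q` that contain `w`. -/
def minimalFace (Q : Set E) (w : E) : Set E :=
  ⋂₀ {F : Set E | IsExtreme ℝ Q F ∧ Convex ℝ F ∧ w ∈ F}

/-- The dimension of the minimal face of `Q` containing `w`. -/
noncomputable def faceDim (Q : Set E) (w : E) : ℕ :=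
  Module.finrank ℝ (vectorSpan ℝ (minimalFace Q w))

/-- First order stationarity of `w` for the maximization of `f` over `Q`. -/
def IsStationary (Q : Set E) (f : E → ℝ) (w : E) : Prop :=
  ∀ y ∈ Q, inner ℝ (gradient f w) (y - w) ≤ 0

/-- The maximal feasible stepsize from `w` in the direction `d`. -/
noncomputable def maxStep (Q : Set E) (w d : E) : ℝ :=
  sSup {a : ℝ | 0 ≤ a ∧ w + a • d ∈ Q}

/-- `d` is a direction that the method may select at `w`: for some maximizer `s` of the linearized
objective over `Q` and some minimizer `v` of it over the minimal face of `w`, it is the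
Frank-Wolfe direction `s - w` if that one has the larger (or equal) slope, and otherwise the
in face direction `w - v`. -/
def IsDirection (Q : Set E) (f : E → ℝ) (w d : E) : Prop :=
  ∃ s ∈ Q, ∃ v ∈ minimalFace Q w,
    (∀ y ∈ Q, inner ℝ (gradient f w) y ≤ inner ℝ (gradient f w) s) ∧
    (∀ y ∈ minimalFace Q w, inner ℝ (gradient f w) v ≤ inner ℝ (gradient f w) y) ∧
    ((inner ℝ (gradient f w) (w - v) ≤ inner ℝ (gradient f w) (s - w) ∧ d = s - w) ∨
      (inner ℝ (gradient f w) (s - w) < inner ℝ (gradient f w) (w - v) ∧ d = w - v))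

/-- `w` is a sequence of iterates of the method, with directions `d` and stepsizes `a`. When the
method stops, at a stationary iterate, the sequence is continued as a constant one (the values of
`d` and `a` from then on are irrelevant). -/
structure IsRun (Q : Set E) (f : E → ℝ) (w d : ℕ → E) (a : ℕ → ℝ) : Prop where
  start : w 0 ∈ Q
  halt : ∀ k, IsStationary Q f (w k) → w (k + 1) = w k
  direction : ∀ k, ¬ IsStationary Q f (w k) → IsDirection Q f (w k) (d k)
  stepsize : ∀ k, ¬ IsStationary Q f (w k) → 0 < a k ∧ a k ≤ maxStep Q (w k) (d k)
  update : ∀ k, ¬ IsStationary Q f (w k) → w (k + 1) = w k + a k • d k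

/-- The number `min (αᵐᵃˣ, c ⟨∇f(w), d⟩ / ‖d‖²)`. -/
noncomputable def stepBound (Q : Set E) (f : E → ℝ) (c : ℝ) (w d : E) : ℝ :=
  min (maxStep Q w d) (c * (inner ℝ (gradient f w) d / ‖d‖ ^ 2))

/-- The lower bound on the stepsizes, with constant `c`, at all steps performed. -/
def StepsizeLowerBound (Q : Set E) (f : E → ℝ) (c : ℝ) (w d : ℕ → E) (a : ℕ → ℝ) : Prop :=
  ∀ k, ¬ IsStationary Q f (w k) → stepBound Q f c (w k) (d k) ≤ a k

/-- The sufficient increase condition, with constants `c` and `ρ`, at all steps performed. -/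
def SufficientIncrease (Q : Set E) (f : E → ℝ) (c ρ : ℝ) (w d : ℕ → E) (a : ℕ → ℝ) : Prop :=
  ∀ k, ¬ IsStationary Q f (w k) →
    ρ * stepBound Q f c (w k) (d k) * inner ℝ (gradient f (w k)) (d k) ≤
      f (w k + a k • d k) - f (w k)

/-- `p` is a strict local maximizer of `f` over `Q`. -/
def IsStrictLocalMaximizer (Q : Set E) (f : E → ℝ) (p : E) : Prop :=
  p ∈ Q ∧ ∀ᶠ z in 𝓝[Q] p, z ≠ p → f z < f p

end

end FDFW

/-! ### The regularized `s`-defective clique formulation -/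

namespace DefectiveClique

section

variable {V : Type*} [Fintype V] [DecidableEq V] (G : SimpleGraph V) [DecidableRel G.Adj]

/-- The Euclidean space of the points `z = (x, y)`, `x` being indexed by the vertices and `y` by
the edges of the complementary graph. -/
abbrev Space : Type _ := EuclideanSpace ℝ (V ⊕ Gᶜ.edgeSet)

variable {G}

/-- The `x` component of a point. -/
def xPart (z : Space G) : V → ℝ := fun i => z (Sum.inl i)

/-- The `y` component of a point. -/
def yPart (z : Space G) : Gᶜ.edgeSet → ℝ := fun e => z (Sum.inr e)

variable (G)

/-- The set `D_s(G)` of the 0-1 vectors indexed by the non-edges with at most `s` ones. -/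
def fakeEdges (s : ℕ) : Set (Gᶜ.edgeSet → ℝ) :=
  {y | (∀ e, y e = 0 ∨ y e = 1) ∧ ∑ e, y e ≤ s}

/-- The relaxation `D'_s(G)` of `D_s(G)`. -/
def relaxedFakeEdges (s : ℕ) : Set (Gᶜ.edgeSet → ℝ) :=
  {y | (∀ e, 0 ≤ y e ∧ y e ≤ 1) ∧ ∑ e, y e ≤ s}

/-- The feasible polytope: the product of the standard simplex and `D'_s(G)`. -/
def polytope (s : ℕ) : Set (Space G) :=
  {z | xPart z ∈ stdSimplex ℝ V ∧ yPart z ∈ relaxedFakeEdges G s}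

open Classical in
/-- The matrix `A(y)`, with entry `y_{ij}` if `{i, j}` is a non-edge (`i ≠ j`) and `0` otherwise. -/
noncomputable def fakeAdj (y : Gᶜ.edgeSet → ℝ) : Matrix V V ℝ :=
  Matrix.of fun i j => if h : s(i, j) ∈ Gᶜ.edgeSet then y ⟨s(i, j), h⟩ else 0

/-- The graph `G(y)`: `G` with the edge `{i, j}` added whenever `y_{ij} = 1`. -/
def augmentedGraph (y : Gᶜ.edgeSet → ℝ) : SimpleGraph V :=
  G ⊔ SimpleGraph.fromEdgeSet {e | ∃ h : e ∈ Gᶜ.edgeSet, y ⟨e, h⟩ = 1}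

/-- The objective `xᵀ (A_G + A(y)) x + (α / 2) ‖x‖² + (β / 2) ‖y‖²`. -/
noncomputable def objective (α β : ℝ) (z : Space G) : ℝ :=
  xPart z ⬝ᵥ (G.adjMatrix ℝ + fakeAdj G (yPart z)).mulVec (xPart z)
    + α / 2 * ∑ i, xPart z i ^ 2 + β / 2 * ∑ e, yPart z e ^ 2

variable {G}

/-- The barycenter `x^{(C)}` of the face of the simplex spanned by `C`. -/
noncomputable def charVec (C : Finset V) : V → ℝ :=
  fun i => if i ∈ C then 1 / (C.card : ℝ) else 0

end

end DefectiveClique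

/-! At a strict local maximizer `p`, convexity of `h` in `y` forces a 0-1 vector using the whole
budget `s`. Second order conditions for exchanging mass between two vertices make the support of `x`
a clique `C` of `G(y)`. First order conditions make the weights equal and `C` maximal
(`exists_maximal_clique`).

Let `M` be the space of zero-sum directions supported in `C` with `y` fixed. On `p + M` the matrix
acts as minus the identity, so `h` is exactly `h(p) - (1 - α/2)‖z - p‖²`. By `slope_nonpos`, the
gradient at `p` is maximized over the polytope only on this face. Finiteness of the vertex set turns
that into a uniform margin `m`. `IsQuadraticFace` records these facts, and the convergence argument
uses nothing else about cliques.

Near `p` but off the face, the minimal face contains a point worse by `m`, while the Frank–Wolfe gap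
is small. The method therefore takes the in face direction, and the step is so short that (S1)
forces it to be maximal. The face dimension drops (`identification_step`), so the target face is
reached within `dim F` steps. Once there, directions stay in `M`, and monotonicity of `h` means that
the distance to `p` does not grow. Under (S2) the squared distance contracts geometrically
(`contraction_step`). -/

namespace FDFW

/-! ### Minimal faces, maximal steps and the face margin of a polytope -/

section Faces

variable {E : Type*} [NormedAddCommGroup E] [InnerProductSpace ℝ E]

/-- The directions along which one can move from `w` both ways inside the convex set `Q`. -/
def faceDirections {Q : Set E} (hQ : Convex ℝ Q) {w : E} (hw : w ∈ Q) : Submodule ℝ E where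
  carrier := {u | ∃ ε : ℝ, 0 < ε ∧ w + ε • u ∈ Q ∧ w - ε • u ∈ Q}
  zero_mem' := ⟨1, one_pos, by simpa using hw, by simpa using hw⟩
  add_mem' := by
    rintro u v ⟨ε, hε, hu, hu'⟩ ⟨δ, hδ, hv, hv'⟩
    have hs : 0 < ε + δ := by positivity
    refine ⟨ε * δ / (ε + δ), by positivity, ?_, ?_⟩
    · have := hQ hu hv (a := δ / (ε + δ)) (b := ε / (ε + δ)) (by positivity) (by positivity)
        (by rw [← add_div, add_comm, div_self hs.ne'])
      convert this using 1
      match_scalars <;> field_simp; ring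
    · have := hQ hu' hv' (a := δ / (ε + δ)) (b := ε / (ε + δ)) (by positivity) (by positivity)
        (by rw [← add_div, add_comm, div_self hs.ne'])
      convert this using 1
      match_scalars <;> field_simp; ring
  smul_mem' := by
    rintro t u ⟨ε, hε, hu, hu'⟩
    rcases lt_trichotomy t 0 with ht | rfl | ht
    · refine ⟨ε / (-t), div_pos hε (neg_pos.2 ht), ?_, ?_⟩
      · have h : w + (ε / (-t)) • t • u = w - ε • u := by
          match_scalars <;> field_simp [ht.ne]
        rwa [h]
      · have h : w - (ε / (-t)) • t • u = w + ε • u := by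
          match_scalars <;> field_simp [ht.ne]
        rwa [h]
    · exact ⟨1, one_pos, by simpa using hw, by simpa using hw⟩
    · refine ⟨ε / t, div_pos hε ht, ?_, ?_⟩
      · have h : w + (ε / t) • t • u = w + ε • u := by
          match_scalars <;> field_simp
        rwa [h]
      · have h : w - (ε / t) • t • u = w - ε • u := by
          match_scalars <;> field_simp
        rwa [h]

variable {Q : Set E}

/-- Moving from `w` towards `v` is free by convexity, so only the move away from `v` needs a
witness. The step is capped at 1 so as not to overshoot `v`. -/
theorem sub_mem_faceDirections {hQ : Convex ℝ Q} {w v : E} {hw : w ∈ Q} (hv : v ∈ Q) {ε : ℝ}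
    (hε : 0 < ε) (h : w + ε • (w - v) ∈ Q) : w - v ∈ faceDirections hQ hw := by
  have h1 := hQ.add_smul_sub_mem hw hv (t := 1 / (1 + ε))
    ⟨by positivity, by rw [div_le_one (by positivity)]; linarith⟩
  have h2 := hQ.add_smul_sub_mem hw h (t := 1 / (1 + ε))
    ⟨by positivity, by rw [div_le_one (by positivity)]; linarith⟩
  rcases le_total ε 1 with h' | h'
  · refine ⟨ε, hε, h, ?_⟩
    have := hQ.add_smul_sub_mem hw hv (t := ε) ⟨hε.le, h'⟩
    convert this using 1
    module
  · refine ⟨1, one_pos, ?_, ?_⟩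
    · have := hQ.add_smul_sub_mem hw h (t := 1 / ε)
        ⟨by positivity, by rw [div_le_one (by positivity)]; linarith⟩
      convert this using 1
      match_scalars <;> field_simp; ring
    · simpa using hv

/-- The minimal face of `w` is cut out by the directions in which one can move both ways. -/
theorem mem_minimalFace (hQ : Convex ℝ Q) {w : E} (hw : w ∈ Q) {v : E} :
    v ∈ minimalFace Q w ↔ v ∈ Q ∧ w - v ∈ faceDirections hQ hw := by
  constructor
  · intro hv
    -- The right-hand side is itself a convex extreme subset containing `w`, hence one of the sets
    -- being intersected.
    refine hv {v | v ∈ Q ∧ w - v ∈ faceDirections hQ hw} ⟨?_, ?_, hw, by simp⟩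
    · refine ⟨fun x hx => hx.1, ?_⟩
      rintro x hx y hy z ⟨-, ε, hε, hz, -⟩ ⟨a, b, ha, hb, hab, rfl⟩
      refine ⟨hx, ?_⟩
      -- The weights cancel `y` from `w + ε (w - z)`, leaving a point on the ray from `x` through
      -- `w`, beyond `w`.
      have h := hQ hz hy (a := 1 / (1 + ε * b)) (b := ε * b / (1 + ε * b)) (by positivity)
        (by positivity) (by field_simp)
      refine sub_mem_faceDirections hx (ε := ε * a / (1 + ε * b)) (by positivity) ?_
      convert h using 1
      obtain rfl : b = 1 - a := by linarith
      have : 1 + ε * (1 - a) ≠ 0 := by positivity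
      match_scalars <;> field_simp <;> ring
    · rintro x ⟨hx, hx'⟩ y ⟨hy, hy'⟩ a b ha hb hab
      refine ⟨hQ hx hy ha hb hab, ?_⟩
      have : w - (a • x + b • y) = a • (w - x) + b • (w - y) := by
        obtain rfl : b = 1 - a := by linarith
        module
      rw [this]
      exact add_mem (Submodule.smul_mem _ _ hx') (Submodule.smul_mem _ _ hy')
  · rintro ⟨hv, ε, hε, h, -⟩ F ⟨hF, -, hwF⟩
    refine hF.2 hv h hwF ⟨ε / (1 + ε), 1 / (1 + ε), by positivity, by positivity,
      by field_simp; ring, ?_⟩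
    match_scalars <;> field_simp; ring

/-- A small multiple of a two-sided direction stays in the minimal face. Dimensions of faces thus
become ranks of submodules, which can be compared by inclusion. -/
theorem vectorSpan_minimalFace (hQ : Convex ℝ Q) {w : E} (hw : w ∈ Q) :
    vectorSpan ℝ (minimalFace Q w) = faceDirections hQ hw := by
  have hwF : w ∈ minimalFace Q w := (mem_minimalFace hQ hw).2 ⟨hw, by simp⟩
  apply le_antisymm
  · rw [vectorSpan_eq_span_vsub_set_left ℝ hwF, Submodule.span_le]
    rintro _ ⟨v, hv, rfl⟩
    exact ((mem_minimalFace hQ hw).1 hv).2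
  · rintro u hu
    obtain ⟨ε, hε, h, h'⟩ := hu
    have hv : w + ε • u ∈ minimalFace Q w := by
      refine (mem_minimalFace hQ hw).2 ⟨h, ?_⟩
      refine sub_mem_faceDirections h one_pos ?_
      convert h' using 1
      module
    have := vsub_mem_vectorSpan ℝ hv hwF
    rw [vsub_eq_sub, add_sub_cancel_left] at this
    have h2 := Submodule.smul_mem _ ε⁻¹ this
    rwa [smul_smul, inv_mul_cancel₀ hε.ne', one_smul] at h2

theorem faceDim_eq (hQ : Convex ℝ Q) {w : E} (hw : w ∈ Q) :
    faceDim Q w = Module.finrank ℝ (faceDirections hQ hw) := by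
  rw [faceDim, vectorSpan_minimalFace hQ hw]

/-- A linear functional that attains its maximum over `Q` at `w` has no ascent direction along the
minimal face of `w`. -/
theorem inner_nonpos_of_mem_faceDirections {hQ : Convex ℝ Q} {w u g : E} {hw : w ∈ Q}
    (hu : u ∈ faceDirections hQ hw) (hg : ∀ v ∈ Q, inner ℝ g (v - w) ≤ 0) : inner ℝ g u ≤ 0 := by
  obtain ⟨ε, hε, h, -⟩ := hu
  have := hg _ h
  rw [add_sub_cancel_left, inner_smul_right] at this
  exact nonpos_of_mul_nonpos_right this hε

theorem bddAbove_steps (hb : Bornology.IsBounded Q) {w d : E} (hd : d ≠ 0) :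
    BddAbove {a : ℝ | 0 ≤ a ∧ w + a • d ∈ Q} := by
  obtain ⟨R, hR⟩ := hb.exists_norm_le
  refine ⟨(R + ‖w‖) / ‖d‖, ?_⟩
  rintro a ⟨ha, h⟩
  rw [le_div_iff₀ (norm_pos_iff.2 hd)]
  have h1 := hR _ h
  have h2 : ‖a • d‖ ≤ ‖w + a • d‖ + ‖w‖ := by
    simpa using norm_sub_le (w + a • d) w
  rw [norm_smul, Real.norm_of_nonneg ha] at h2
  linarith

theorem add_smul_mem_of_le_maxStep (hQ : Convex ℝ Q) (hc : IsCompact Q) {w d : E} (hd : d ≠ 0)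
    (hw : w ∈ Q) {a : ℝ} (ha : 0 ≤ a) (ha' : a ≤ maxStep Q w d) : w + a • d ∈ Q := by
  have hcl : IsClosed {a : ℝ | 0 ≤ a ∧ w + a • d ∈ Q} :=
    isClosed_Ici.inter (hc.isClosed.preimage (by fun_prop))
  have hmem := hcl.csSup_mem ⟨0, le_rfl, by simpa using hw⟩ (bddAbove_steps hc.isBounded hd)
  change 0 ≤ maxStep Q w d ∧ w + maxStep Q w d • d ∈ Q at hmem
  rcases ha.eq_or_lt with rfl | ha0
  · simpa using hw
  have hpos : 0 < maxStep Q w d := ha0.trans_le ha'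
  have := hQ.add_smul_mem hw hmem.2 (t := a / maxStep Q w d)
    ⟨by positivity, by rw [div_le_one hpos]; exact ha'⟩
  rwa [smul_smul, div_mul_cancel₀ _ hpos.ne'] at this

theorem le_maxStep (hb : Bornology.IsBounded Q) {w d : E} (hd : d ≠ 0) {a : ℝ} (ha : 0 ≤ a)
    (h : w + a • d ∈ Q) : a ≤ maxStep Q w d :=
  le_csSup (bddAbove_steps hb hd) ⟨ha, h⟩

/-- A maximal step along a direction of the minimal face lowers the dimension of that face. -/
theorem faceDim_add_maxStep_lt [FiniteDimensional ℝ E] (hQ : Convex ℝ Q) (hc : IsCompact Q)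
    {w d : E} (hd : d ≠ 0) (hw : w ∈ Q) (hdw : d ∈ faceDirections hQ hw)
    (hmax : 0 ≤ maxStep Q w d) :
    faceDim Q (w + maxStep Q w d • d) < faceDim Q w := by
  have hw' : w + maxStep Q w d • d ∈ Q := add_smul_mem_of_le_maxStep hQ hc hd hw hmax le_rfl
  rw [faceDim_eq hQ hw, faceDim_eq hQ hw']
  apply Submodule.finrank_lt_finrank_of_lt
  refine lt_of_le_of_ne ?_ ?_
  · rintro u ⟨ε, hε, h, h'⟩
    obtain ⟨δ, hδ, -, h3⟩ := hdw
    generalize maxStep Q w d = a at *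
    -- The point `w` lies between the endpoint `w + a d` and `w - δ d`, so room along `u` at the
    -- endpoint yields room at `w`, scaled by `δ / (a + δ)`.
    have hs : 0 < a + δ := by positivity
    refine ⟨δ / (a + δ) * ε, by positivity, ?_, ?_⟩
    · have := hQ h h3 (a := δ / (a + δ)) (b := a / (a + δ)) (by positivity) (by positivity)
        (by field_simp; ring)
      convert this using 1
      match_scalars <;> field_simp <;> ring
    · have := hQ h' h3 (a := δ / (a + δ)) (b := a / (a + δ)) (by positivity) (by positivity)
        (by field_simp; ring)
      convert this using 1
      match_scalars <;> field_simp <;> ring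
  -- The direction `d` itself is lost: otherwise a step longer than the maximal one would be
  -- feasible.
  · intro heq
    rw [← heq] at hdw
    obtain ⟨δ, hδ, h, -⟩ := hdw
    rw [add_assoc, ← add_smul] at h
    have := le_maxStep hc.isBounded hd (by positivity) h
    linarith

/-- Over a polytope, a linear functional maximized at `p` is bounded away from its maximum at some
point of the minimal face of any point that is not a maximizer. -/
theorem exists_face_margin {S : Set E} (hS : S.Finite) (hQS : convexHull ℝ S = Q)
    (hQ : Convex ℝ Q) {p g : E} (hg : ∀ v ∈ Q, inner ℝ g (v - p) ≤ 0) :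
    ∃ m : ℝ, 0 < m ∧ ∀ v (hv : v ∈ Q), inner ℝ g (v - p) ≠ 0 →
      ∃ w ∈ Q, v - w ∈ faceDirections hQ hv ∧ inner ℝ g (w - p) ≤ -m := by
  -- The margin is the smallest gap among the finitely many non-maximizing generators.
  have hm : ∃ m : ℝ, 0 < m ∧ ∀ w ∈ S, inner ℝ g (w - p) ≠ 0 → inner ℝ g (w - p) ≤ -m := by
    rcases Set.eq_empty_or_nonempty {w ∈ S | inner ℝ g (w - p) ≠ 0} with h | h
    · exact ⟨1, one_pos, fun w hw hw' => (Set.eq_empty_iff_forall_notMem.1 h w ⟨hw, hw'⟩).elim⟩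
    · obtain ⟨w, ⟨hw, hw'⟩, hmax⟩ := Set.exists_max_image {w ∈ S | inner ℝ g (w - p) ≠ 0}
        (fun w => inner ℝ g (w - p)) (hS.subset fun _ h => h.1) h
      refine ⟨-inner ℝ g (w - p), ?_, fun v hv hv' => by simpa using hmax v ⟨hv, hv'⟩⟩
      have := hg w (hQS ▸ subset_convexHull ℝ S hw)
      exact neg_pos.2 (lt_of_le_of_ne this hw')
  obtain ⟨m, hm, hmS⟩ := hm
  refine ⟨m, hm, fun v hv hne => ?_⟩
  have hv' := hv
  rw [← hQS, ← hS.coe_toFinset, Finset.mem_convexHull'] at hv'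
  obtain ⟨l, hl, hsum, hlv⟩ := hv'
  have hSQ : ∀ w ∈ S, w ∈ Q := fun w hw => hQS ▸ subset_convexHull ℝ S hw
  have hex : ∃ w ∈ hS.toFinset, l w * inner ℝ g (w - p) ≠ 0 := by
    by_contra! hcon
    apply hne
    have : v - p = ∑ w ∈ hS.toFinset, l w • (w - p) := by
      simp only [smul_sub, Finset.sum_sub_distrib, ← Finset.sum_smul, hsum, hlv, one_smul]
    rw [this, inner_sum]
    exact Finset.sum_eq_zero fun w hw => by rw [inner_smul_right]; exact hcon w hw
  obtain ⟨w, hw, hw'⟩ := hex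
  have hlw : 0 < l w := lt_of_le_of_ne (hl w hw) (Ne.symm (left_ne_zero_of_mul hw'))
  have hwS : w ∈ S := by simpa using hw
  refine ⟨w, hSQ w hwS, ?_, hmS w hwS (right_ne_zero_of_mul hw')⟩
  refine sub_mem_faceDirections (hSQ w hwS) hlw ?_
  classical
  -- Moving away from a generator of weight `l w` by that amount keeps all coefficients nonnegative:
  -- the one at `w` becomes `(l w)²`.
  have key : v + l w • (v - w) = ∑ x ∈ hS.toFinset,
      ((1 + l w) * l x - if x = w then l w else 0) • x := by
    simp only [sub_smul, Finset.sum_sub_distrib, ite_smul, zero_smul, Finset.sum_ite_eq', hw,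
      if_true, mul_smul, ← Finset.smul_sum, hlv]
    module
  rw [key]
  refine hQ.sum_mem (fun x hx => ?_) ?_ fun x hx => hSQ x (by simpa using hx)
  · split_ifs with h
    · subst h; nlinarith
    · have := hl x hx
      nlinarith [mul_nonneg hlw.le this]
  · simp only [Finset.sum_sub_distrib, ← Finset.mul_sum, hsum, Finset.sum_ite_eq', hw, if_true]
    ring

end Faces

/-! ### Identification of the face and contraction on it -/

section Convergence

variable {E : Type*} [NormedAddCommGroup E] [InnerProductSpace ℝ E] [CompleteSpace E]
  {Q : Set E} {f : E → ℝ}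

/-- The in face direction is selected only when its slope exceeds the Frank–Wolfe gap, so the gap
bounds the slope from below in both cases. -/
theorem IsDirection.sub_le {w d : E} (h : IsDirection Q f w d) {y : E} (hy : y ∈ Q) :
    inner ℝ (gradient f w) (y - w) ≤ inner ℝ (gradient f w) d := by
  obtain ⟨s, -, v, -, hs, -, h⟩ := h
  have h1 : inner ℝ (gradient f w) (y - w) ≤ inner ℝ (gradient f w) (s - w) := by
    rw [inner_sub_right, inner_sub_right]
    linarith [hs y hy]
  rcases h with ⟨-, rfl⟩ | ⟨h, rfl⟩
  · exact h1
  · exact h1.trans h.le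

theorem IsDirection.slope_pos {w d : E} (h : IsDirection Q f w d) (hs : ¬ IsStationary Q f w) :
    0 < inner ℝ (gradient f w) d := by
  rw [IsStationary] at hs
  push Not at hs
  obtain ⟨y, hy, hy'⟩ := hs
  exact hy'.trans_le (h.sub_le hy)

theorem IsDirection.ne_zero {w d : E} (h : IsDirection Q f w d) (hs : ¬ IsStationary Q f w) :
    d ≠ 0 := by
  rintro rfl
  simpa using h.slope_pos hs

theorem IsDirection.norm_le (hQ : Convex ℝ Q) {D : ℝ} (hD : ∀ v ∈ Q, ∀ w ∈ Q, ‖v - w‖ ≤ D)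
    {w d : E} (hw : w ∈ Q) (h : IsDirection Q f w d) : ‖d‖ ≤ D := by
  obtain ⟨s, hs, v, hv, -, -, ⟨-, rfl⟩ | ⟨-, rfl⟩⟩ := h
  · exact hD _ hs _ hw
  · exact hD _ hw _ ((mem_minimalFace hQ hw).1 hv).1

theorem stepBound_nonneg {c : ℝ} (hc : 0 < c) {w d : E} (h : IsDirection Q f w d)
    (hs : ¬ IsStationary Q f w) (hmax : 0 ≤ maxStep Q w d) : 0 ≤ stepBound Q f c w d := by
  have := h.slope_pos hs
  exact le_min hmax (by positivity)

theorem IsRun.mem (hQ : Convex ℝ Q) (hc : IsCompact Q) {z d : ℕ → E} {a : ℕ → ℝ}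
    (h : IsRun Q f z d a) (k : ℕ) : z k ∈ Q := by
  induction k with
  | zero => exact h.start
  | succ k ih =>
    by_cases hs : IsStationary Q f (z k)
    · rwa [h.halt k hs]
    · rw [h.update k hs]
      have ha := h.stepsize k hs
      exact add_smul_mem_of_le_maxStep hQ hc ((h.direction k hs).ne_zero hs) ih ha.1.le ha.2

theorem IsRun.monotone {z d : ℕ → E} {a : ℕ → ℝ} (h : IsRun Q f z d a) {c ρ : ℝ} (hc : 0 < c)
    (hρ : 0 < ρ) (hinc : SufficientIncrease Q f c ρ z d a) : Monotone fun k => f (z k) := by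
  refine monotone_nat_of_le_succ fun k => ?_
  by_cases hs : IsStationary Q f (z k)
  · rw [h.halt k hs]
  · have h1 := hinc k hs
    have h2 := (h.direction k hs).slope_pos hs
    have h3 := stepBound_nonneg hc (h.direction k hs) hs
      ((h.stepsize k hs).1.le.trans (h.stepsize k hs).2)
    rw [h.update k hs]
    have : 0 ≤ ρ * stepBound Q f c (z k) (d k) * inner ℝ (gradient f (z k)) (d k) := by positivity
    linarith

/-- `Q ∩ (p + M)` is a face of `Q`, exposed with margin `m` by the gradient of `f` at `p`, which
contains the ball of radius `r` around `p` in `p + M`, and on which `f` is the concave quadratic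
`f p - κ ‖z - p‖ ^ 2`. -/
structure IsQuadraticFace (hQ : Convex ℝ Q) (f : E → ℝ) (p : E) (M : Submodule ℝ E)
    (κ r m : ℝ) : Prop where
  mem : p ∈ Q
  kappa_pos : 0 < κ
  radius_pos : 0 < r
  margin_pos : 0 < m
  ball_mem : ∀ u ∈ M, ‖u‖ ≤ r → p + u ∈ Q
  sub_eq : ∀ z ∈ Q, z - p ∈ M → f p - f z = κ * ‖z - p‖ ^ 2
  inner_gradient : ∀ z ∈ Q, z - p ∈ M → ∀ u ∈ M,
    inner ℝ (gradient f z) u = -2 * κ * inner ℝ (z - p) u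
  inner_nonpos : ∀ z ∈ Q, inner ℝ (gradient f p) (z - p) ≤ 0
  margin : ∀ v (hv : v ∈ Q), v - p ∉ M → ∃ w ∈ Q, v - w ∈ faceDirections hQ hv ∧
    inner ℝ (gradient f p) (w - p) ≤ -m

namespace IsQuadraticFace

variable {hQ : Convex ℝ Q} {p : E} {M : Submodule ℝ E} {κ r m : ℝ}

/-- A maximizer over `Q` of a linear functional close to the gradient at `p` lies on the face. -/
theorem sub_mem_of_isMaximizer (H : IsQuadraticFace hQ f p M κ r m) {D : ℝ}
    (hD : ∀ v ∈ Q, ∀ w ∈ Q, ‖v - w‖ ≤ D) {g : E} (hg : ‖g - gradient f p‖ * D ≤ m / 8) {s : E}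
    (hs : s ∈ Q) (hmax : ∀ y ∈ Q, inner ℝ g y ≤ inner ℝ g s) : s - p ∈ M := by
  by_contra hM
  obtain ⟨w, hw, hsw, hm⟩ := H.margin s hs hM
  -- Since `s` maximizes `g`, the point `w` of its minimal face does too; but `w` is worse than `p`
  -- by at least `m - m/8`.
  have h1 : inner ℝ g (s - w) ≤ 0 := inner_nonpos_of_mem_faceDirections hsw fun v hv => by
    rw [inner_sub_right]; linarith [hmax v hv]
  have h2 : inner ℝ (g - gradient f p) (w - p) ≤ m / 8 :=
    (real_inner_le_norm _ _).trans ((mul_le_mul_of_nonneg_left (hD _ hw _ H.mem)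
      (norm_nonneg _)).trans hg)
  have h3 := hmax p H.mem
  have h4 := H.margin_pos
  simp only [inner_sub_right, inner_sub_left] at h1 h2 hm
  linarith

/-- On the face, `z` maximizes the linearization at `p`, hence so does each point of its minimal
face; the margin excludes maximizers off the face. -/
theorem sub_mem_of_mem_minimalFace (H : IsQuadraticFace hQ f p M κ r m) {z v : E} (hz : z ∈ Q)
    (hzM : z - p ∈ M) (hv : v ∈ minimalFace Q z) : v - p ∈ M := by
  obtain ⟨hvQ, hzv⟩ := (mem_minimalFace hQ hz).1 hv
  have h0 : inner ℝ (gradient f p) (z - p) = 0 := by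
    rw [H.inner_gradient p H.mem (by simp) _ hzM]; simp
  have h1 : inner ℝ (gradient f p) (z - v) ≤ 0 :=
    inner_nonpos_of_mem_faceDirections hzv fun y hy => by
      have := H.inner_nonpos y hy
      simp only [inner_sub_right] at this h0 ⊢
      linarith
  by_contra hM
  obtain ⟨w, hw, hvw, hm⟩ := H.margin v hvQ hM
  have h2 := H.inner_nonpos v hvQ
  have h3 : inner ℝ (gradient f p) (v - w) ≤ 0 :=
    inner_nonpos_of_mem_faceDirections hvw fun y hy => by
      have := H.inner_nonpos y hy
      simp only [inner_sub_right] at this h0 h1 h2 ⊢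
      linarith
  have h4 := H.margin_pos
  simp only [inner_sub_right] at *
  linarith

/-- Invariance of the face under the method: both candidate directions are differences of points on
it. -/
theorem direction_mem (H : IsQuadraticFace hQ f p M κ r m) {D : ℝ}
    (hD : ∀ v ∈ Q, ∀ w ∈ Q, ‖v - w‖ ≤ D) {z d : E} (hz : z ∈ Q) (hzM : z - p ∈ M)
    (hg : ‖gradient f z - gradient f p‖ * D ≤ m / 8) (hd : IsDirection Q f z d) : d ∈ M := by
  obtain ⟨s, hs, v, hv, hmax, -, ⟨-, rfl⟩ | ⟨-, rfl⟩⟩ := hd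
  · simpa using sub_mem (H.sub_mem_of_isMaximizer hD hg hs hmax) hzM
  · simpa using sub_mem hzM (H.sub_mem_of_mem_minimalFace hz hzM hv)

/-- Near `p` and off the face, the method is not stationary, and it makes a short maximal step
that lowers the dimension of the minimal face. -/
theorem identification_step [FiniteDimensional ℝ E] (H : IsQuadraticFace hQ f p M κ r m)
    (hcpt : IsCompact Q) {D : ℝ} (hDpos : 0 < D)
    (hD : ∀ v ∈ Q, ∀ w ∈ Q, ‖v - w‖ ≤ D) {c : ℝ} (hc : 0 < c) {z : E} (hz : z ∈ Q)
    (hzM : z - p ∉ M) (hg : ‖gradient f z - gradient f p‖ * D ≤ m / 8)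
    (hp : ‖gradient f p‖ * ‖z - p‖ ≤ m / 8)
    (hp' : ‖gradient f p‖ * ‖z - p‖ ≤ 3 * c * m ^ 2 / (8 * D ^ 2)) :
    ¬ IsStationary Q f z ∧ ∀ d, IsDirection Q f z d → ∀ a, 0 < a → a ≤ maxStep Q z d →
      stepBound Q f c z d ≤ a →
      faceDim Q (z + a • d) < faceDim Q z ∧
      ‖z + a • d - p‖ ≤ (1 + 2 * ‖gradient f p‖ * D / m) * ‖z - p‖ := by
  have hm := H.margin_pos
  obtain ⟨w, hw, hzw, hwm⟩ := H.margin z hz hzM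
  have hest : ∀ v ∈ Q, ∀ w ∈ Q, |inner ℝ (gradient f z - gradient f p) (v - w)| ≤ m / 8 :=
    fun v hv w hw => (abs_real_inner_le_norm _ _).trans
      ((mul_le_mul_of_nonneg_left (hD _ hv _ hw) (norm_nonneg _)).trans hg)
  have hest' : |inner ℝ (gradient f p) (z - p)| ≤ ‖gradient f p‖ * ‖z - p‖ :=
    abs_real_inner_le_norm _ _
  have haway : 3 * m / 4 ≤ inner ℝ (gradient f z) (z - w) := by
    have h1 := (abs_le.1 (hest z hz w hw)).1
    have h2 := (abs_le.1 hest').1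
    simp only [inner_sub_right, inner_sub_left] at *
    linarith
  have hst : ¬ IsStationary Q f z := by
    intro hst
    have := inner_nonpos_of_mem_faceDirections hzw hst
    linarith
  refine ⟨hst, fun d hd a ha hamax hab => ?_⟩
  have hslope := hd.slope_pos hst
  have hd0 := hd.ne_zero hst
  have hdD := hd.norm_le hQ hD hz
  have hdpos : 0 < ‖d‖ := norm_pos_iff.2 hd0
  obtain ⟨s, hs, v, hv, hmax, hmin, hd⟩ := hd
  obtain ⟨hvQ, hzv⟩ := (mem_minimalFace hQ hz).1 hv
  have hv1 : 3 * m / 4 ≤ inner ℝ (gradient f z) (z - v) := by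
    have := hmin w ((mem_minimalFace hQ hz).2 ⟨hw, hzw⟩)
    simp only [inner_sub_right] at *
    linarith
  -- The gap is at most `m/8` from the change of gradient plus `m/8` from `z` not being `p`. This is
  -- below `3m/4`, so the in face direction wins.
  have hFW : inner ℝ (gradient f z) (s - z) ≤ m / 4 := by
    have h1 := (abs_le.1 (hest s hs z hz)).2
    have h2 := (abs_le.1 hest').1
    have h3 := H.inner_nonpos s hs
    simp only [inner_sub_right, inner_sub_left] at *
    linarith
  rcases hd with ⟨hle, -⟩ | ⟨-, rfl⟩
  · linarith
  have hpd : m / 2 ≤ inner ℝ (gradient f p) (z - v) := by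
    have h1 := (abs_le.1 (hest z hz v hvQ)).2
    rw [inner_sub_left] at h1
    linarith
  have hmaxnn : 0 ≤ maxStep Q z (z - v) := ha.le.trans hamax
  -- Along the direction the linearization at `p` grows at rate at least `m/2`, yet it cannot exceed
  -- its value at `p`.
  have hstep : maxStep Q z (z - v) ≤ 2 * (‖gradient f p‖ * ‖z - p‖) / m := by
    have h1 := add_smul_mem_of_le_maxStep hQ hcpt hd0 hz hmaxnn le_rfl
    have h2 := H.inner_nonpos _ h1
    have h3 : z + maxStep Q z (z - v) • (z - v) - p
        = (z - p) + maxStep Q z (z - v) • (z - v) := by abel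
    rw [h3, inner_add_right, inner_smul_right] at h2
    rw [le_div_iff₀ hm]
    have h4 := (abs_le.1 hest').1
    have h5 := mul_le_mul_of_nonneg_left hpd hmaxnn
    linarith
  have hbound : maxStep Q z (z - v) ≤
      c * (inner ℝ (gradient f z) (z - v) / ‖z - v‖ ^ 2) := by
    calc maxStep Q z (z - v) ≤ 2 * (‖gradient f p‖ * ‖z - p‖) / m := hstep
      _ ≤ 2 * (3 * c * m ^ 2 / (8 * D ^ 2)) / m := by gcongr
      _ = c * ((3 * m / 4) / D ^ 2) := by field_simp; ring
      _ ≤ _ := by gcongr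
  -- The minimum in (S1) is attained by the maximal step, which is therefore forced.
  have haeq : a = maxStep Q z (z - v) := by
    rw [stepBound, min_eq_left hbound] at hab
    exact le_antisymm hamax hab
  subst haeq
  refine ⟨faceDim_add_maxStep_lt hQ hcpt hd0 hz hzv hmaxnn, ?_⟩
  calc ‖z + maxStep Q z (z - v) • (z - v) - p‖
      = ‖(z - p) + maxStep Q z (z - v) • (z - v)‖ := by congr 1; abel
    _ ≤ ‖z - p‖ + maxStep Q z (z - v) * ‖z - v‖ := by
        refine (norm_add_le _ _).trans ?_
        rw [norm_smul, Real.norm_of_nonneg hmaxnn]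
    _ ≤ ‖z - p‖ + 2 * (‖gradient f p‖ * ‖z - p‖) / m * D := by gcongr
    _ = _ := by ring

/-- On the face and near `p`, the sufficient increase condition yields a contraction. -/
theorem contraction_step (H : IsQuadraticFace hQ f p M κ r m) (hcpt : IsCompact Q)
    {D : ℝ} (hDpos : 0 < D) (hD : ∀ v ∈ Q, ∀ w ∈ Q, ‖v - w‖ ≤ D) {c ρ : ℝ} (hc : 0 < c)
    (hρ : 0 < ρ) {z : E} (hz : z ∈ Q) (hzM : z - p ∈ M)
    (hg : ‖gradient f z - gradient f p‖ * D ≤ m / 8) (hr : ‖z - p‖ ≤ r / 2) (hzp : z ≠ p) :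
    ¬ IsStationary Q f z ∧ ∀ d, IsDirection Q f z d → ∀ a : ℝ, z + a • d ∈ Q →
      ρ * stepBound Q f c z d * inner ℝ (gradient f z) d ≤ f (z + a • d) - f z →
      ‖z + a • d - p‖ ^ 2 ≤ (1 - ρ * min (r / D) (4 * c * κ * r ^ 2 / D ^ 2)) * ‖z - p‖ ^ 2 := by
  have hκ := H.kappa_pos
  have hrpos := H.radius_pos
  have hn : 0 < ‖z - p‖ := norm_pos_iff.2 (sub_ne_zero.2 hzp)
  -- The point of the ball opposite to `z` gives a slope linear in `‖z - p‖`.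
  have hpmem : p + (-(r / ‖z - p‖)) • (z - p) ∈ Q := by
    refine H.ball_mem _ (Submodule.smul_mem _ _ hzM) ?_
    rw [norm_smul, norm_neg, Real.norm_of_nonneg (by positivity), div_mul_cancel₀ _ hn.ne']
  have hslope0 : 2 * κ * r * ‖z - p‖ ≤
      inner ℝ (gradient f z) (p + (-(r / ‖z - p‖)) • (z - p) - z) := by
    have h1 : p + (-(r / ‖z - p‖)) • (z - p) - z = (-(1 + r / ‖z - p‖)) • (z - p) := by module
    rw [h1, inner_smul_right, H.inner_gradient z hz hzM _ hzM, real_inner_self_eq_norm_sq]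
    have : -(1 + r / ‖z - p‖) * (-2 * κ * ‖z - p‖ ^ 2)
        = 2 * κ * r * ‖z - p‖ + 2 * κ * ‖z - p‖ ^ 2 := by field_simp; ring
    rw [this]
    have : 0 ≤ 2 * κ * ‖z - p‖ ^ 2 := by positivity
    linarith
  have hst : ¬ IsStationary Q f z := by
    intro hst
    have h1 := hst _ hpmem
    have : 0 < 2 * κ * r * ‖z - p‖ := by positivity
    linarith
  refine ⟨hst, fun d hd a haQ hinc => ?_⟩
  have hσ := hslope0.trans (hd.sub_le hpmem)
  set σ := inner ℝ (gradient f z) d with hσdef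
  have hd0 := hd.ne_zero hst
  have hdpos : 0 < ‖d‖ := norm_pos_iff.2 hd0
  have hdD := hd.norm_le hQ hD hz
  have hdM := H.direction_mem hD hz hzM hg hd
  -- Since `z` is within `r/2` of `p`, a displacement of length `r/2` in `M` stays in the ball.
  have hmax : r / (2 * D) ≤ maxStep Q z d := by
    refine le_maxStep hcpt.isBounded hd0 (by positivity) ?_
    have h1 : z + (r / (2 * D)) • d = p + ((z - p) + (r / (2 * D)) • d) := by abel
    rw [h1]
    refine H.ball_mem _ (add_mem hzM (Submodule.smul_mem _ _ hdM)) ?_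
    refine (norm_add_le _ _).trans ?_
    rw [norm_smul, Real.norm_of_nonneg (by positivity)]
    have : r / (2 * D) * ‖d‖ ≤ r / (2 * D) * D := by gcongr
    have h2 : r / (2 * D) * D = r / 2 := by field_simp
    linarith
  have hσ0 : 0 < 2 * κ * r * ‖z - p‖ := by positivity
  have hσpos : 0 < σ := hσ0.trans_le hσ
  have hbound : min (r / (2 * D)) (c * (2 * κ * r * ‖z - p‖ / D ^ 2)) ≤ stepBound Q f c z d := by
    refine min_le_min hmax ?_
    gcongr
  have hlow : κ * (min (r / D) (4 * c * κ * r ^ 2 / D ^ 2) * ‖z - p‖ ^ 2) ≤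
      stepBound Q f c z d * σ := by
    calc κ * (min (r / D) (4 * c * κ * r ^ 2 / D ^ 2) * ‖z - p‖ ^ 2)
        ≤ min (r / (2 * D)) (c * (2 * κ * r * ‖z - p‖ / D ^ 2)) * (2 * κ * r * ‖z - p‖) := by
          rcases min_choice (r / (2 * D)) (c * (2 * κ * r * ‖z - p‖ / D ^ 2)) with h | h
          · rw [h]
            calc κ * (min (r / D) (4 * c * κ * r ^ 2 / D ^ 2) * ‖z - p‖ ^ 2)
                ≤ κ * (r / D * ‖z - p‖ ^ 2) := by gcongr; exact min_le_left _ _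
              _ = κ * (r / D * (‖z - p‖ * ‖z - p‖)) := by ring
              _ ≤ κ * (r / D * (r * ‖z - p‖)) := by gcongr; linarith
              _ = _ := by field_simp
          · rw [h]
            calc κ * (min (r / D) (4 * c * κ * r ^ 2 / D ^ 2) * ‖z - p‖ ^ 2)
                ≤ κ * (4 * c * κ * r ^ 2 / D ^ 2 * ‖z - p‖ ^ 2) := by
                  gcongr; exact min_le_right _ _
              _ = _ := by ring
      _ ≤ _ := by
          refine mul_le_mul hbound hσ hσ0.le ?_
          exact (le_min (by positivity) (by positivity)).trans hbound
  have h1 := H.sub_eq z hz hzM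
  have h2 := H.sub_eq _ haQ (by
    have : z + a • d - p = (z - p) + a • d := by abel
    rw [this]; exact add_mem hzM (Submodule.smul_mem _ _ hdM))
  have h3 := mul_le_mul_of_nonneg_left hlow hρ.le
  refine le_of_mul_le_mul_left ?_ hκ
  rw [mul_assoc] at hinc
  linarith

/-- Local convergence of the method to a point in the relative interior of a strictly
complementary face on which the objective is a concave quadratic. -/
theorem local_convergence [FiniteDimensional ℝ E] (H : IsQuadraticFace hQ f p M κ r m)
    (hcpt : IsCompact Q) (hcont : ContinuousAt (gradient f) p) {c : ℝ} (hc : 0 < c)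
    {ε : ℝ} (hε : 0 < ε) :
    ∃ U ∈ 𝓝 p, ∀ (z d : ℕ → E) (a : ℕ → ℝ), IsRun Q f z d a → StepsizeLowerBound Q f c z d a →
      ∀ kbar : ℕ, z kbar ∈ U →
        (Monotone (fun k => f (z k)) → ∀ k, kbar + faceDim Q (z kbar) ≤ k →
          z k - p ∈ M ∧ ‖z k - p‖ ≤ ε) ∧
        (∀ ρ : ℝ, 0 < ρ → SufficientIncrease Q f c ρ z d a →
          Filter.Tendsto z Filter.atTop (𝓝 p)) := by
  have hm := H.margin_pos
  have hκ := H.kappa_pos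
  have hrpos := H.radius_pos
  obtain ⟨D, hDpos, hD⟩ : ∃ D : ℝ, 0 < D ∧ ∀ v ∈ Q, ∀ w ∈ Q, ‖v - w‖ ≤ D := by
    obtain ⟨R, hR⟩ := hcpt.isBounded.exists_norm_le
    have hR0 := (norm_nonneg p).trans (hR p H.mem)
    refine ⟨2 * R + 1, by positivity, fun v hv w hw => (norm_sub_le v w).trans ?_⟩
    linarith [hR v hv, hR w hw]
  obtain ⟨η, hη, hηε, hηg, hηr, hηp, hηp'⟩ : ∃ η : ℝ, 0 < η ∧ η ≤ ε ∧
      (∀ z, ‖z - p‖ ≤ η → ‖gradient f z - gradient f p‖ * D ≤ m / 8) ∧ η ≤ r / 2 ∧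
      ‖gradient f p‖ * η ≤ m / 8 ∧ ‖gradient f p‖ * η ≤ 3 * c * m ^ 2 / (8 * D ^ 2) := by
    obtain ⟨δ, hδ, hδ'⟩ := Metric.continuousAt_iff.1 hcont (m / (8 * D)) (by positivity)
    set g := ‖gradient f p‖ with hg
    have hg0 : 0 ≤ g := norm_nonneg _
    -- Dividing by `g + 1` covers the case of a vanishing gradient.
    have key : ∀ b : ℝ, 0 < b → ∀ t : ℝ, t ≤ b / (g + 1) → g * t ≤ b := by
      intro b hb t ht
      calc g * t ≤ g * (b / (g + 1)) := by gcongr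
        _ ≤ (g + 1) * (b / (g + 1)) := by gcongr; linarith
        _ = b := by field_simp
    refine ⟨min (min ε (δ / 2)) (min (r / 2) (min (m / 8 / (g + 1))
      (3 * c * m ^ 2 / (8 * D ^ 2) / (g + 1)))), ?_, ?_, ?_, ?_, ?_, ?_⟩
    · simp only [lt_min_iff]
      refine ⟨⟨hε, by positivity⟩, by positivity, by positivity, by positivity⟩
    · exact (min_le_left _ _).trans (min_le_left _ _)
    · intro z hz
      have h1 : ‖z - p‖ ≤ δ / 2 := hz.trans ((min_le_left _ _).trans (min_le_right _ _))
      have h2 := hδ' (x := z) (by rw [dist_eq_norm]; linarith)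
      rw [dist_eq_norm] at h2
      calc ‖gradient f z - gradient f p‖ * D ≤ m / (8 * D) * D := by gcongr
        _ = m / 8 := by field_simp
    · exact (min_le_right _ _).trans (min_le_left _ _)
    · exact key _ (by positivity) _
        ((min_le_right _ _).trans ((min_le_right _ _).trans (min_le_left _ _)))
    · exact key _ (by positivity) _
        ((min_le_right _ _).trans ((min_le_right _ _).trans (min_le_right _ _)))
  set K := 1 + 2 * ‖gradient f p‖ * D / m with hK
  have hK1 : 1 ≤ K := by
    have : 0 ≤ 2 * ‖gradient f p‖ * D / m := by positivity
    linarith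
  set N := Module.finrank ℝ E
  -- Each identification step may multiply the distance to `p` by `K`, and at most `N` of them
  -- occur, so the iterates stay within `η`.
  refine ⟨Metric.closedBall p (η / K ^ N), Metric.closedBall_mem_nhds _ (by positivity), ?_⟩
  intro z d a hrun hlow kbar hkbar
  have hmem := hrun.mem hQ hcpt
  rw [mem_closedBall_iff_norm] at hkbar
  -- Induction on the face dimension; at dimension 0 a further drop is impossible, so the iterate is
  -- already on the face.
  have hident : ∀ n k, faceDim Q (z k) ≤ n → ‖z k - p‖ ≤ η / K ^ n →
      ∃ i ≤ n, z (k + i) - p ∈ M ∧ ‖z (k + i) - p‖ ≤ η := by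
    intro n
    induction n with
    | zero =>
      intro k hk hk'
      simp only [pow_zero, div_one] at hk'
      by_cases hM : z k - p ∈ M
      · exact ⟨0, le_rfl, hM, hk'⟩
      · exfalso
        obtain ⟨hst, hstep⟩ := H.identification_step hcpt hDpos hD hc (hmem k) hM (hηg _ hk')
          ((mul_le_mul_of_nonneg_left hk' (norm_nonneg _)).trans hηp)
          ((mul_le_mul_of_nonneg_left hk' (norm_nonneg _)).trans hηp')
        have := (hstep _ (hrun.direction k hst) _ (hrun.stepsize k hst).1
          (hrun.stepsize k hst).2 (hlow k hst)).1
        omega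
    | succ n ih =>
      intro k hk hk'
      have hk2 : ‖z k - p‖ ≤ η := hk'.trans (div_le_self hη.le (one_le_pow₀ hK1))
      by_cases hM : z k - p ∈ M
      · exact ⟨0, Nat.zero_le _, hM, hk2⟩
      · obtain ⟨hst, hstep⟩ := H.identification_step hcpt hDpos hD hc (hmem k) hM (hηg _ hk2)
          ((mul_le_mul_of_nonneg_left hk2 (norm_nonneg _)).trans hηp)
          ((mul_le_mul_of_nonneg_left hk2 (norm_nonneg _)).trans hηp')
        obtain ⟨h1, h2⟩ := hstep _ (hrun.direction k hst) _ (hrun.stepsize k hst).1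
          (hrun.stepsize k hst).2 (hlow k hst)
        rw [← hrun.update k hst] at h1 h2
        obtain ⟨i, hi, h3⟩ := ih (k + 1) (by omega) (by
          refine h2.trans ((mul_le_mul_of_nonneg_left hk' (by positivity)).trans_eq ?_)
          rw [pow_succ, ← hK]; field_simp)
        exact ⟨i + 1, by omega, by rwa [show k + (i + 1) = k + 1 + i by ring]⟩
  have hstay : Monotone (fun k => f (z k)) → ∀ k, z k - p ∈ M ∧ ‖z k - p‖ ≤ η →
      ∀ j, k ≤ j → z j - p ∈ M ∧ ‖z j - p‖ ≤ η := by
    intro hmono k hk j hj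
    induction j, hj using Nat.le_induction with
    | base => exact hk
    | succ j hj ih =>
      have hM : z (j + 1) - p ∈ M := by
        by_cases hs : IsStationary Q f (z j)
        · rw [hrun.halt j hs]; exact ih.1
        · rw [hrun.update j hs, add_sub_right_comm]
          exact add_mem ih.1 (Submodule.smul_mem _ _
            (H.direction_mem hD (hmem j) ih.1 (hηg _ ih.2) (hrun.direction j hs)))
      refine ⟨hM, le_trans ?_ ih.2⟩
      have h1 := H.sub_eq _ (hmem j) ih.1
      have h2 := H.sub_eq _ (hmem (j + 1)) hM
      have h3 : f (z j) ≤ f (z (j + 1)) := hmono (Nat.le_succ j)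
      have h4 : ‖z (j + 1) - p‖ ^ 2 ≤ ‖z j - p‖ ^ 2 :=
        le_of_mul_le_mul_left (by linarith) hκ
      exact (pow_le_pow_iff_left₀ (norm_nonneg _) (norm_nonneg _) two_ne_zero).1 h4
  have hphase : Monotone (fun k => f (z k)) → ∀ k, kbar + faceDim Q (z kbar) ≤ k →
      z k - p ∈ M ∧ ‖z k - p‖ ≤ η := by
    intro hmono k hk
    have hN : faceDim Q (z kbar) ≤ N := Submodule.finrank_le _
    obtain ⟨i, hi, h⟩ := hident _ kbar le_rfl (hkbar.trans (by gcongr))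
    exact hstay hmono _ h k (by omega)
  refine ⟨fun hmono k hk => ⟨(hphase hmono k hk).1, (hphase hmono k hk).2.trans hηε⟩, ?_⟩
  intro ρ hρ hinc
  have hmono := hrun.monotone hc hρ hinc
  set k₀ := kbar + faceDim Q (z kbar)
  -- Truncation at 0 is for large `ρ`, where the factor could be negative.
  set q := max 0 (1 - ρ * min (r / D) (4 * c * κ * r ^ 2 / D ^ 2)) with hq
  have hq0 : 0 ≤ q := le_max_left _ _
  have hq1 : q < 1 := by
    have : 0 < ρ * min (r / D) (4 * c * κ * r ^ 2 / D ^ 2) :=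
      mul_pos hρ (lt_min (by positivity) (by positivity))
    exact max_lt one_pos (by linarith)
  have hcontr : ∀ k, k₀ ≤ k → ‖z (k + 1) - p‖ ^ 2 ≤ q * ‖z k - p‖ ^ 2 := by
    intro k hk
    obtain ⟨hM, hkη⟩ := hphase hmono k hk
    obtain ⟨hM', -⟩ := hphase hmono (k + 1) (by omega)
    by_cases hzp : z k = p
    · have h2 := H.sub_eq _ (hmem (k + 1)) hM'
      have h3 : f (z k) ≤ f (z (k + 1)) := hmono (Nat.le_succ k)
      rw [hzp] at h3 ⊢
      have : ‖z (k + 1) - p‖ ^ 2 ≤ 0 := nonpos_of_mul_nonpos_right (by linarith) hκ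
      simpa using this
    · obtain ⟨hst, hstep⟩ := H.contraction_step hcpt hDpos hD hc hρ (hmem k) hM (hηg _ hkη)
        (hkη.trans hηr) hzp
      have := hstep _ (hrun.direction k hst) (a k)
        (by rw [← hrun.update k hst]; exact hmem _) (hinc k hst)
      rw [← hrun.update k hst] at this
      exact this.trans (mul_le_mul_of_nonneg_right (le_max_right _ _) (by positivity))
  have hgeom : ∀ j, ‖z (j + k₀) - p‖ ^ 2 ≤ q ^ j * ‖z k₀ - p‖ ^ 2 := by
    intro j
    induction j with
    | zero => simp
    | succ j ih =>
      have := hcontr (j + k₀) (by omega)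
      rw [show j + 1 + k₀ = j + k₀ + 1 by ring, pow_succ' q]
      calc _ ≤ q * ‖z (j + k₀) - p‖ ^ 2 := this
        _ ≤ q * (q ^ j * ‖z k₀ - p‖ ^ 2) := by gcongr
        _ = _ := by ring
  rw [← Filter.tendsto_add_atTop_iff_nat k₀, tendsto_iff_norm_sub_tendsto_zero]
  have h0 : Filter.Tendsto (fun j => q ^ j * ‖z k₀ - p‖ ^ 2) Filter.atTop (𝓝 0) := by
    simpa using (tendsto_pow_atTop_nhds_zero_of_lt_one hq0 hq1).mul_const (‖z k₀ - p‖ ^ 2)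
  have h1 := squeeze_zero (fun j => by positivity) hgeom h0
  have h2 := h1.sqrt
  simpa using h2

end IsQuadraticFace

end Convergence

/-! ### Optimality conditions along lines -/

section LocalMaximizers

variable {E : Type*} [NormedAddCommGroup E] [InnerProductSpace ℝ E] {Q : Set E} {f : E → ℝ} {p : E}

/-- Divide `f (p + t u) ≤ f p` by `t > 0` and let `t` tend to 0; if `l = 0`, divide once more. -/
theorem IsStrictLocalMaximizer.first_second_order (hQ : Convex ℝ Q)
    (hp : IsStrictLocalMaximizer Q f p) {u : E} {ε : ℝ} (hε : 0 < ε) (hu : p + ε • u ∈ Q)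
    {l q : ℝ} (hf : ∀ t : ℝ, f (p + t • u) = f p + t * l + t ^ 2 * q) :
    l ≤ 0 ∧ (l = 0 → q ≤ 0) := by
  have hle : ∀ᶠ z in 𝓝[Q] p, f z ≤ f p := by
    filter_upwards [hp.2] with z hz
    by_cases h : z = p
    · rw [h]
    · exact (hz h).le
  have ht : Filter.Tendsto (fun t : ℝ => p + t • u) (𝓝[>] 0) (𝓝[Q] p) := by
    refine tendsto_nhdsWithin_iff.2 ⟨?_, ?_⟩
    · refine Filter.Tendsto.mono_left ?_ nhdsWithin_le_nhds
      have : Continuous fun t : ℝ => p + t • u := by fun_prop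
      simpa using this.tendsto 0
    · filter_upwards [Ioo_mem_nhdsGT hε] with t ht
      have := hQ.add_smul_mem hp.1 hu (t := t / ε)
        ⟨div_nonneg ht.1.le hε.le, (div_le_one hε).2 ht.2.le⟩
      rwa [smul_smul, div_mul_cancel₀ _ hε.ne'] at this
  have hev : ∀ᶠ t : ℝ in 𝓝[>] 0, l + t * q ≤ 0 := by
    filter_upwards [ht.eventually hle, self_mem_nhdsWithin] with t h1 h2
    rw [hf] at h1
    have h2 : 0 < t := h2
    refine nonpos_of_mul_nonpos_right (a := t) ?_ h2
    linarith
  constructor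
  · have hlim : Filter.Tendsto (fun t : ℝ => l + t * q) (𝓝[>] 0) (𝓝 l) := by
      refine Filter.Tendsto.mono_left ?_ nhdsWithin_le_nhds
      have : Continuous fun t : ℝ => l + t * q := by fun_prop
      simpa using this.tendsto 0
    exact le_of_tendsto hlim hev
  · rintro rfl
    obtain ⟨t, h1, h2⟩ := (hev.and self_mem_nhdsWithin).exists
    exact nonpos_of_mul_nonpos_right (by linarith) h2

theorem IsStrictLocalMaximizer.of_mem_faceDirections {hQ : Convex ℝ Q}
    (hp : IsStrictLocalMaximizer Q f p) {u : E} (hu : u ∈ faceDirections hQ hp.1)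
    {l q : ℝ} (hf : ∀ t : ℝ, f (p + t • u) = f p + t * l + t ^ 2 * q) :
    l = 0 ∧ q ≤ 0 := by
  obtain ⟨ε, hε, h, h'⟩ := hu
  obtain ⟨h1, h2⟩ := hp.first_second_order hQ hε h hf
  obtain ⟨h3, -⟩ := hp.first_second_order (u := -u) (l := -l) (q := q) hQ hε
    (by simpa [sub_eq_add_neg] using h') fun t => by
      rw [smul_neg, ← neg_smul, hf]; ring
  have : l = 0 := by linarith
  exact ⟨this, h2 this⟩

end LocalMaximizers

end FDFW

namespace DefectiveClique

open FDFW Matrix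

/-! ### Two-sided directions and vertices of the feasible polytope -/

section Polytope

variable {V : Type*} {G : SimpleGraph V}

/-- The point with the given `x` and `y` components. -/
def ofParts (x : V → ℝ) (y : Gᶜ.edgeSet → ℝ) : Space G := WithLp.toLp 2 (Sum.elim x y)

@[simp] theorem xPart_ofParts (x : V → ℝ) (y : Gᶜ.edgeSet → ℝ) : xPart (ofParts x y) = x := rfl

@[simp] theorem yPart_ofParts (x : V → ℝ) (y : Gᶜ.edgeSet → ℝ) : yPart (ofParts x y) = y := rfl

@[simp] theorem xPart_add (z w : Space G) : xPart (z + w) = xPart z + xPart w := rfl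

@[simp] theorem yPart_add (z w : Space G) : yPart (z + w) = yPart z + yPart w := rfl

@[simp] theorem xPart_sub (z w : Space G) : xPart (z - w) = xPart z - xPart w := rfl

@[simp] theorem yPart_sub (z w : Space G) : yPart (z - w) = yPart z - yPart w := rfl

@[simp] theorem xPart_smul (t : ℝ) (z : Space G) : xPart (t • z) = t • xPart z := rfl

@[simp] theorem yPart_smul (t : ℝ) (z : Space G) : yPart (t • z) = t • yPart z := rfl

theorem ext_parts {z w : Space G} (hx : xPart z = xPart w) (hy : yPart z = yPart w) : z = w := by
  ext (i | e)
  · exact congrFun hx i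
  · exact congrFun hy e

theorem continuous_xPart (i : V) : Continuous fun z : Space G => xPart z i := by
  unfold xPart; fun_prop

theorem continuous_yPart (e : Gᶜ.edgeSet) : Continuous fun z : Space G => yPart z e := by
  unfold yPart; fun_prop

variable [Fintype V] [DecidableEq V] [DecidableRel G.Adj]

theorem inner_eq (z w : Space G) : inner ℝ z w = xPart z ⬝ᵥ xPart w + yPart z ⬝ᵥ yPart w := by
  simp only [PiLp.inner_apply, Fintype.sum_sum_type, dotProduct, xPart, yPart]
  simp [mul_comm]

theorem abs_xPart_le (z : Space G) (i : V) : |xPart z i| ≤ ‖z‖ := by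
  simpa [xPart] using PiLp.norm_apply_le z (Sum.inl i)

theorem mem_polytope {s : ℕ} {z : Space G} : z ∈ polytope G s ↔
    ((∀ i, 0 ≤ xPart z i) ∧ ∑ i, xPart z i = 1) ∧
      (∀ e, 0 ≤ yPart z e ∧ yPart z e ≤ 1) ∧ ∑ e, yPart z e ≤ s := Iff.rfl

theorem xPart_le_one {s : ℕ} {z : Space G} (hz : z ∈ polytope G s) (i : V) : xPart z i ≤ 1 := by
  obtain ⟨⟨h0, h1⟩, -⟩ := mem_polytope.1 hz
  rw [← h1]
  exact Finset.single_le_sum (fun j _ => h0 j) (Finset.mem_univ i)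

theorem convex_polytope (s : ℕ) : Convex ℝ (polytope G s) := by
  intro z hz w hw a b ha hb hab
  rw [mem_polytope] at *
  obtain ⟨⟨h1, h2⟩, h3, h4⟩ := hz
  obtain ⟨⟨k1, k2⟩, k3, k4⟩ := hw
  simp only [xPart_add, yPart_add, xPart_smul, yPart_smul, Pi.add_apply, Pi.smul_apply,
    smul_eq_mul, Finset.sum_add_distrib, ← Finset.mul_sum, h2, k2]
  refine ⟨⟨fun i => ?_, by linarith⟩, fun e => ⟨?_, ?_⟩, ?_⟩
  · have := mul_nonneg ha (h1 i); have := mul_nonneg hb (k1 i); linarith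
  · have := mul_nonneg ha (h3 e).1; have := mul_nonneg hb (k3 e).1; linarith
  · have := mul_le_mul_of_nonneg_left (h3 e).2 ha
    have := mul_le_mul_of_nonneg_left (k3 e).2 hb
    linarith
  · have := mul_le_mul_of_nonneg_left h4 ha
    have := mul_le_mul_of_nonneg_left k4 hb
    have : a * s + b * s = s := by rw [← add_mul, hab, one_mul]
    linarith

theorem isCompact_polytope (s : ℕ) : IsCompact (polytope G s) := by
  have hx := continuous_xPart (G := G)
  have hy := continuous_yPart (G := G)
  refine Metric.isCompact_of_isClosed_isBounded ?_ ?_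
  · have : polytope G s = ((⋂ i, {z | 0 ≤ xPart z i}) ∩ {z | ∑ i, xPart z i = 1}) ∩
        ((⋂ e, ({z | 0 ≤ yPart z e} ∩ {z | yPart z e ≤ 1})) ∩ {z | ∑ e, yPart z e ≤ s}) := by
      ext z
      simp [mem_polytope]
    rw [this]
    refine ((isClosed_iInter fun i => isClosed_le continuous_const (hx i)).inter
      (isClosed_eq (continuous_finsetSum _ fun i _ => hx i) continuous_const)).inter
      ((isClosed_iInter fun e => (isClosed_le continuous_const (hy e)).inter
        (isClosed_le (hy e) continuous_const)).inter
        (isClosed_le (continuous_finsetSum _ fun e _ => hy e) continuous_const))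
  · refine isBounded_iff_forall_norm_le.2 ⟨√(∑ _i : V ⊕ Gᶜ.edgeSet, 1), fun z hz => ?_⟩
    rw [EuclideanSpace.norm_eq]
    refine Real.sqrt_le_sqrt (Finset.sum_le_sum fun i _ => ?_)
    have h := mem_polytope.1 hz
    rw [sq_le_one_iff₀ (norm_nonneg _), Real.norm_eq_abs, abs_le]
    rcases i with i | e
    · exact ⟨by linarith [h.1.1 i, show xPart z i = z (Sum.inl i) from rfl], xPart_le_one hz i⟩
    · exact ⟨by linarith [(h.2.1 e).1, show yPart z e = z (Sum.inr e) from rfl], (h.2.1 e).2⟩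

theorem sum_single_sub_single {ι : Type*} [Fintype ι] [DecidableEq ι] (i j : ι) :
    ∑ k, (Pi.single i (1 : ℝ) - Pi.single j (1 : ℝ) : ι → ℝ) k = 0 := by
  simp [Finset.sum_sub_distrib]

theorem add_smul_single_sub_single_mem {s : ℕ} {z : Space G} (hz : z ∈ polytope G s) {i j : V}
    (hij : i ≠ j) {ε : ℝ} (hε : 0 ≤ ε) (hj : ε ≤ xPart z j) :
    z + ε • ofParts (Pi.single i 1 - Pi.single j 1) 0 ∈ polytope G s := by
  obtain ⟨⟨h1, h2⟩, h3⟩ := mem_polytope.1 hz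
  rw [mem_polytope]
  simp only [xPart_add, yPart_add, xPart_smul, yPart_smul, xPart_ofParts, yPart_ofParts, smul_zero,
    add_zero]
  refine ⟨⟨fun k => ?_, ?_⟩, h3⟩
  · have := h1 k
    rcases eq_or_ne k j with rfl | hk
    · simp [hij.symm]; linarith
    · rcases eq_or_ne k i with rfl | hk'
      · simp [hk]; linarith
      · simp [hk, hk', this]
  · simp only [Pi.add_apply, Pi.smul_apply, Finset.sum_add_distrib, smul_eq_mul, ← Finset.mul_sum,
      sum_single_sub_single, h2]
    ring

theorem x_exchange_mem_faceDirections {s : ℕ} {z : Space G} (hz : z ∈ polytope G s) {i j : V}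
    (hij : i ≠ j) (hi : xPart z i ≠ 0) (hj : xPart z j ≠ 0) :
    ofParts (Pi.single i 1 - Pi.single j 1) 0 ∈ faceDirections (convex_polytope s) hz := by
  obtain ⟨⟨h1, -⟩, -⟩ := mem_polytope.1 hz
  have hi' := lt_of_le_of_ne (h1 i) hi.symm
  have hj' := lt_of_le_of_ne (h1 j) hj.symm
  refine ⟨min (xPart z i) (xPart z j), lt_min hi' hj',
    add_smul_single_sub_single_mem hz hij (lt_min hi' hj').le (min_le_right _ _), ?_⟩
  have := add_smul_single_sub_single_mem hz hij.symm (lt_min hi' hj').le (min_le_left _ _)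
  convert this using 1
  apply ext_parts
  · simp only [xPart_sub, xPart_add, xPart_smul, xPart_ofParts]; module
  · simp

theorem y_mem_faceDirections {s : ℕ} {z : Space G} (hz : z ∈ polytope G s) {e : Gᶜ.edgeSet}
    (h0 : 0 < yPart z e) (h1 : yPart z e < 1) (hs : ∑ e, yPart z e < s) :
    ofParts 0 (Pi.single e 1) ∈ faceDirections (convex_polytope s) hz := by
  obtain ⟨hx, h3, h4⟩ := mem_polytope.1 hz
  set ε := min (yPart z e) (min (1 - yPart z e) (s - ∑ e, yPart z e)) with hεd
  have hε : 0 < ε := lt_min h0 (lt_min (by linarith) (by linarith))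
  have hε1 : ε ≤ yPart z e := min_le_left _ _
  have hε2 : ε ≤ 1 - yPart z e := (min_le_right _ _).trans (min_le_left _ _)
  have hε3 : ε ≤ s - ∑ e, yPart z e := (min_le_right _ _).trans (min_le_right _ _)
  refine ⟨ε, hε, ?_, ?_⟩ <;> rw [mem_polytope] <;>
    simp only [xPart_add, yPart_add, xPart_sub, yPart_sub, xPart_smul, yPart_smul, xPart_ofParts,
      yPart_ofParts, smul_zero, Pi.add_apply, Pi.sub_apply, Pi.smul_apply,
      smul_eq_mul, Finset.sum_add_distrib, Finset.sum_sub_distrib, ← Finset.mul_sum,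
      Finset.sum_pi_single', Finset.mem_univ, if_true] <;>
    refine ⟨by simpa using hx, fun e' => ?_, by linarith⟩ <;>
    have := h3 e' <;>
    rcases eq_or_ne e' e with rfl | he
  · simp; constructor <;> linarith
  · simp [he, this]
  · simp; constructor <;> linarith
  · simp [he, this]

/-- The exchange preserves the sum, so it is available even when the budget is tight. -/
theorem y_exchange_mem_faceDirections {s : ℕ} {z : Space G} (hz : z ∈ polytope G s)
    {e e' : Gᶜ.edgeSet} (hee : e ≠ e') (h0 : 0 < yPart z e) (h1 : yPart z e < 1)
    (h0' : 0 < yPart z e') (h1' : yPart z e' < 1) :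
    ofParts 0 (Pi.single e 1 - Pi.single e' 1) ∈ faceDirections (convex_polytope s) hz := by
  obtain ⟨hx, h3, h4⟩ := mem_polytope.1 hz
  set ε := min (min (yPart z e) (1 - yPart z e)) (min (yPart z e') (1 - yPart z e'))
  have hε : 0 < ε := lt_min (lt_min h0 (by linarith)) (lt_min h0' (by linarith))
  have hε1 : ε ≤ yPart z e := (min_le_left _ _).trans (min_le_left _ _)
  have hε2 : ε ≤ 1 - yPart z e := (min_le_left _ _).trans (min_le_right _ _)
  have hε3 : ε ≤ yPart z e' := (min_le_right _ _).trans (min_le_left _ _)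
  have hε4 : ε ≤ 1 - yPart z e' := (min_le_right _ _).trans (min_le_right _ _)
  have hsum := sum_single_sub_single e e'
  refine ⟨ε, hε, ?_, ?_⟩ <;> rw [mem_polytope] <;>
    simp only [xPart_add, yPart_add, xPart_sub, yPart_sub, xPart_smul, yPart_smul, xPart_ofParts,
      yPart_ofParts, smul_zero, Pi.add_apply, Pi.sub_apply, Pi.smul_apply,
      smul_eq_mul, Finset.sum_add_distrib, Finset.sum_sub_distrib, ← Finset.mul_sum] at hsum ⊢ <;>
    refine ⟨by simpa using hx, fun k => ?_, by rw [hsum]; linarith⟩ <;>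
    have := h3 k <;>
    rcases eq_or_ne k e with rfl | hk
  · simp [hee]; constructor <;> linarith
  · rcases eq_or_ne k e' with rfl | hk'
    · simp [hk]; constructor <;> linarith
    · simp [hk, hk', this]
  · simp [hee]; constructor <;> linarith
  · rcases eq_or_ne k e' with rfl | hk'
    · simp [hk]; constructor <;> linarith
    · simp [hk, hk', this]

/-- If the `y` component is not a 0-1 vector, then it can be moved both ways. -/
theorem exists_y_mem_faceDirections {s : ℕ} {z : Space G} (hz : z ∈ polytope G s)
    {e : Gᶜ.edgeSet} (he0 : yPart z e ≠ 0) (he1 : yPart z e ≠ 1) :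
    ∃ v : Gᶜ.edgeSet → ℝ, v ≠ 0 ∧ ofParts 0 v ∈ faceDirections (convex_polytope s) hz := by
  obtain ⟨hx, h3, h4⟩ := mem_polytope.1 hz
  have hfrac : ∀ e, yPart z e ≠ 0 → yPart z e ≠ 1 → 0 < yPart z e ∧ yPart z e < 1 :=
    fun e h h' => ⟨lt_of_le_of_ne (h3 e).1 h.symm, lt_of_le_of_ne (h3 e).2 h'⟩
  obtain ⟨h0, h1⟩ := hfrac e he0 he1
  rcases h4.lt_or_eq with hlt | heq
  · exact ⟨Pi.single e 1, by simp, y_mem_faceDirections hz h0 h1 hlt⟩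
  by_cases hex : ∃ e', e ≠ e' ∧ yPart z e' ≠ 0 ∧ yPart z e' ≠ 1
  · obtain ⟨e', hee, h0', h1'⟩ := hex
    obtain ⟨h0', h1'⟩ := hfrac e' h0' h1'
    refine ⟨Pi.single e 1 - Pi.single e' 1, fun h => ?_,
      y_exchange_mem_faceDirections hz hee h0 h1 h0' h1'⟩
    have := congrFun h e
    simp [hee] at this
  -- With a tight budget and a single fractional entry, that entry is `s` minus an integer, yet
  -- strictly between 0 and 1.
  · exfalso
    push Not at hex
    have hint : ∀ e' ∈ Finset.univ.erase e,
        yPart z e' = ((if yPart z e' = 1 then 1 else 0 : ℤ) : ℝ) := by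
      intro e' he'
      have hne : e ≠ e' := (Finset.ne_of_mem_erase he').symm
      split_ifs with h
      · simpa using h
      · by_contra h'
        exact h (hex e' hne (by simpa using h'))
    rw [← Finset.add_sum_erase _ _ (Finset.mem_univ e), Finset.sum_congr rfl hint,
      ← Int.cast_sum] at heq
    generalize (∑ e' ∈ Finset.univ.erase e, (if yPart z e' = 1 then 1 else 0 : ℤ)) = n at heq
    have h5 : yPart z e = (((s : ℤ) - n : ℤ) : ℝ) := by push_cast; linarith
    rw [h5] at h0 h1
    have h6 : (0 : ℤ) < s - n := by exact_mod_cast h0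
    have h7 : (s : ℤ) - n < 1 := by exact_mod_cast h1
    omega

theorem exists_x_exchange {s : ℕ} {z : Space G} (hz : z ∈ polytope G s)
    {i : V} (hi1 : xPart z i ≠ 1) : ∃ j, i ≠ j ∧ xPart z j ≠ 0 := by
  by_contra! hcon
  apply hi1
  rw [← (mem_polytope.1 hz).1.2]
  refine (Finset.sum_eq_single i (fun j _ hj => hcon j hj.symm) (by simp)).symm

theorem eq_zero_of_mem_faceDirections_of_mem_extremePoints {E : Type*} [NormedAddCommGroup E]
    [InnerProductSpace ℝ E] {Q : Set E} {hQ : Convex ℝ Q} {w u : E} {hw : w ∈ Q}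
    (hext : w ∈ Q.extremePoints ℝ) (hu : u ∈ faceDirections hQ hw) : u = 0 := by
  obtain ⟨ε, hε, h, h'⟩ := hu
  have := hext.2 h h' ⟨1 / 2, 1 / 2, by norm_num, by norm_num, by norm_num, by module⟩
  simpa [hε.ne'] using this

/-- A fractional coordinate would give a nonzero two-sided direction, so the vertices are 0-1
vectors. -/
theorem finite_extremePoints (s : ℕ) : ((polytope G s).extremePoints ℝ).Finite := by
  have hfin : (Set.univ.pi fun _ : V ⊕ Gᶜ.edgeSet => ({0, 1} : Set ℝ)).Finite :=
    Set.Finite.pi fun _ => Set.toFinite _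
  refine (hfin.preimage (f := fun z : Space G => fun i => z i)
    (fun z _ w _ h => by ext i; exact congrFun h i)).subset ?_
  rintro z hz (i | e) -
  · change xPart z i ∈ ({0, 1} : Set ℝ)
    by_contra hcon
    simp only [Set.mem_insert_iff, Set.mem_singleton_iff, not_or] at hcon
    obtain ⟨j, hij, hj⟩ := exists_x_exchange hz.1 hcon.2
    have := eq_zero_of_mem_faceDirections_of_mem_extremePoints hz
      (x_exchange_mem_faceDirections hz.1 hij hcon.1 hj)
    have := congrFun (congrArg xPart this) i
    simp [hij] at this
    simp [xPart] at this
  · change yPart z e ∈ ({0, 1} : Set ℝ)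
    by_contra hcon
    simp only [Set.mem_insert_iff, Set.mem_singleton_iff, not_or] at hcon
    obtain ⟨v, hv, hv'⟩ := exists_y_mem_faceDirections hz.1 hcon.1 hcon.2
    have := eq_zero_of_mem_faceDirections_of_mem_extremePoints hz hv'
    exact hv (congrArg yPart this)

/-- Krein–Milman; the hull of a finite set is already closed. -/
theorem convexHull_extremePoints (s : ℕ) :
    convexHull ℝ ((polytope G s).extremePoints ℝ) = polytope G s := by
  rw [← ((finite_extremePoints s).isClosed_convexHull ℝ).closure_eq]
  exact closure_convexHull_extremePoints (isCompact_polytope s) (convex_polytope s)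

end Polytope

/-! ### Expansion of the objective along lines -/

section Objective

theorem dotProduct_mulVec_comm {V : Type*} [Fintype V] {M : Matrix V V ℝ} (hM : Mᵀ = M)
    (x u : V → ℝ) :
    x ⬝ᵥ M *ᵥ u = u ⬝ᵥ M *ᵥ x := by
  rw [dotProduct_mulVec, ← mulVec_transpose, hM, dotProduct_comm]

variable {V : Type*} [DecidableEq V] (G : SimpleGraph V) [DecidableRel G.Adj]

theorem fakeAdj_add_smul (y v : Gᶜ.edgeSet → ℝ) (t : ℝ) :
    fakeAdj G (y + t • v) = fakeAdj G y + t • fakeAdj G v := by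
  ext i j
  simp only [fakeAdj, Matrix.add_apply, Matrix.smul_apply, Matrix.of_apply]
  split_ifs <;> simp

@[simp] theorem fakeAdj_zero : fakeAdj G 0 = 0 := by
  ext i j
  simp [fakeAdj]

theorem fakeAdj_transpose (y : Gᶜ.edgeSet → ℝ) : (fakeAdj G y)ᵀ = fakeAdj G y := by
  ext i j
  simp only [fakeAdj, Matrix.transpose_apply, Matrix.of_apply, Sym2.eq_swap (a := j)]

/-- The weighted adjacency matrix `A_G + A(y)`. -/
noncomputable def weightedAdj (y : Gᶜ.edgeSet → ℝ) : Matrix V V ℝ := G.adjMatrix ℝ + fakeAdj G y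

theorem weightedAdj_transpose (y : Gᶜ.edgeSet → ℝ) : (weightedAdj G y)ᵀ = weightedAdj G y := by
  rw [weightedAdj, Matrix.transpose_add, fakeAdj_transpose, SimpleGraph.transpose_adjMatrix]

variable {G} in
theorem weightedAdj_apply {y : Gᶜ.edgeSet → ℝ} (hy : ∀ e, y e = 0 ∨ y e = 1) (i j : V)
    [Decidable ((augmentedGraph G y).Adj i j)] :
    weightedAdj G y i j = if (augmentedGraph G y).Adj i j then 1 else 0 := by
  by_cases h : G.Adj i j
  · have h1 : (augmentedGraph G y).Adj i j := Or.inl h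
    have h2 : s(i, j) ∉ Gᶜ.edgeSet := by simp [h]
    simp [weightedAdj, fakeAdj, h, h1]
  · by_cases he : s(i, j) ∈ Gᶜ.edgeSet
    · have hne : i ≠ j := ((SimpleGraph.mem_edgeSet _).1 he).ne
      have hiff : (augmentedGraph G y).Adj i j ↔ y ⟨s(i, j), he⟩ = 1 := by
        simp only [augmentedGraph, SimpleGraph.sup_adj, h, SimpleGraph.fromEdgeSet_adj, false_or,
          Set.mem_ofPred_eq]
        exact ⟨fun h => h.1.2, fun h => ⟨⟨he, h⟩, hne⟩⟩
      rw [weightedAdj, Matrix.add_apply, SimpleGraph.adjMatrix_apply, if_neg h, fakeAdj,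
        Matrix.of_apply, dif_pos he, zero_add]
      rcases hy ⟨s(i, j), he⟩ with h0 | h0 <;> simp [hiff, h0]
    · have hiff : ¬ (augmentedGraph G y).Adj i j := by
        simp only [augmentedGraph, SimpleGraph.sup_adj, h, SimpleGraph.fromEdgeSet_adj, false_or,
          Set.mem_ofPred_eq]
        exact fun h => he h.1.1
      rw [weightedAdj, Matrix.add_apply, SimpleGraph.adjMatrix_apply, if_neg h, fakeAdj,
        Matrix.of_apply, dif_neg he, zero_add, if_neg hiff]

variable [Fintype V]

/-- The directional derivative of the objective. -/
noncomputable def slope (α β : ℝ) (z u : Space G) : ℝ :=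
  2 * (xPart u ⬝ᵥ weightedAdj G (yPart z) *ᵥ xPart z) +
    xPart z ⬝ᵥ fakeAdj G (yPart u) *ᵥ xPart z + α * (xPart u ⬝ᵥ xPart z) +
    β * (yPart u ⬝ᵥ yPart z)

/-- The coefficient of second order of the objective along a line. -/
noncomputable def curvature (α β : ℝ) (z u : Space G) : ℝ :=
  xPart u ⬝ᵥ weightedAdj G (yPart z) *ᵥ xPart u +
    2 * (xPart u ⬝ᵥ fakeAdj G (yPart u) *ᵥ xPart z) + α / 2 * (xPart u ⬝ᵥ xPart u) +
    β / 2 * (yPart u ⬝ᵥ yPart u)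

theorem objective_eq (α β : ℝ) (z : Space G) :
    objective G α β z = xPart z ⬝ᵥ weightedAdj G (yPart z) *ᵥ xPart z
      + α / 2 * (xPart z ⬝ᵥ xPart z) + β / 2 * (yPart z ⬝ᵥ yPart z) := by
  simp only [objective, weightedAdj, dotProduct, pow_two]

/-- The objective is a cubic polynomial. Its cubic term is linear in the `y` direction and quadratic
in the `x` direction, so it vanishes when only one block moves. -/
theorem objective_add_smul (α β : ℝ) (z u : Space G) (t : ℝ) :
    objective G α β (z + t • u) = objective G α β z + t * slope G α β z u +
      t ^ 2 * curvature G α β z u + t ^ 3 * (xPart u ⬝ᵥ fakeAdj G (yPart u) *ᵥ xPart u) := by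
  have h1 : weightedAdj G (yPart z + t • yPart u) =
      weightedAdj G (yPart z) + t • fakeAdj G (yPart u) := by
    rw [weightedAdj, fakeAdj_add_smul, weightedAdj, add_assoc]
  have h2 := dotProduct_mulVec_comm (weightedAdj_transpose G (yPart z)) (xPart z) (xPart u)
  have h3 := dotProduct_mulVec_comm (fakeAdj_transpose G (yPart u)) (xPart z) (xPart u)
  simp only [objective_eq, slope, curvature, xPart_add, yPart_add, xPart_smul, yPart_smul, h1,
    add_mulVec, mulVec_add, dotProduct_add, add_dotProduct, smul_mulVec, mulVec_smul,
    dotProduct_smul, smul_dotProduct, smul_eq_mul, h2, h3, dotProduct_comm (xPart z) (xPart u),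
    dotProduct_comm (yPart z) (yPart u)]
  ring

theorem contDiff_objective (α β : ℝ) : ContDiff ℝ 1 (objective G α β) := by
  have hx : ∀ i, ContDiff ℝ 1 fun z : Space G => xPart z i := fun i => by
    unfold xPart; fun_prop
  have hy : ∀ e, ContDiff ℝ 1 fun z : Space G => yPart z e := fun e => by
    unfold yPart; fun_prop
  have hA : ∀ i j, ContDiff ℝ 1 fun z : Space G => fakeAdj G (yPart z) i j := fun i j => by
    simp only [fakeAdj, Matrix.of_apply]
    split_ifs with h
    · exact hy _
    · exact contDiff_const
  simp only [funext (objective_eq G α β), dotProduct, mulVec, weightedAdj, Matrix.add_apply]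
  fun_prop

theorem continuous_gradient_objective (α β : ℝ) : Continuous (gradient (objective G α β)) :=
  (LinearIsometryEquiv.continuous _).comp
    ((contDiff_objective G α β).continuous_fderiv one_ne_zero)

theorem inner_gradient_objective (α β : ℝ) (z u : Space G) :
    inner ℝ (gradient (objective G α β) z) u = slope G α β z u := by
  have h := ((contDiff_objective G α β).differentiable one_ne_zero z).hasFDerivAt.hasLineDerivAt u
  rw [gradient, InnerProductSpace.toDual_symm_apply]
  refine HasDerivAt.unique h ?_
  simp only [objective_add_smul]
  have hid := hasDerivAt_id (0 : ℝ)
  have := (((hid.mul_const (slope G α β z u)).const_add (objective G α β z)).add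
    ((hid.pow 2).mul_const (curvature G α β z u))).add
    ((hid.pow 3).mul_const (xPart u ⬝ᵥ fakeAdj G (yPart u) *ᵥ xPart u))
  convert this using 1
  · rfl
  · simp

variable {G}

theorem weightedAdj_mulVec_eq {y : Gᶜ.edgeSet → ℝ} (hy : ∀ e, y e = 0 ∨ y e = 1) {x : V → ℝ}
    {i : V} (h : ∀ j, x j ≠ 0 → i ≠ j → (augmentedGraph G y).Adj i j) :
    (weightedAdj G y *ᵥ x) i = ∑ j, x j - x i := by
  classical
  rw [mulVec, dotProduct, ← Finset.add_sum_erase _ _ (Finset.mem_univ i),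
    ← Finset.add_sum_erase _ x (Finset.mem_univ i), weightedAdj_apply hy, if_neg (by simp),
    zero_mul, zero_add, add_sub_cancel_left]
  refine Finset.sum_congr rfl fun j hj => ?_
  have hij : i ≠ j := (Finset.ne_of_mem_erase hj).symm
  rw [weightedAdj_apply hy]
  by_cases hx : x j = 0
  · simp [hx]
  · simp [h j hx hij]

/-- A missing neighbour `k` costs its mass; this is the source of strict complementarity outside the
clique. -/
theorem weightedAdj_mulVec_le {y : Gᶜ.edgeSet → ℝ} (hy : ∀ e, y e = 0 ∨ y e = 1) {x : V → ℝ}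
    (hx : ∀ j, 0 ≤ x j) {i k : V} (h : ¬ (augmentedGraph G y).Adj i k) :
    (weightedAdj G y *ᵥ x) i ≤ ∑ j, x j - x k := by
  classical
  rw [mulVec, dotProduct, ← Finset.add_sum_erase _ _ (Finset.mem_univ k),
    ← Finset.add_sum_erase _ x (Finset.mem_univ k), weightedAdj_apply hy, if_neg h,
    zero_mul, zero_add, add_sub_cancel_left]
  refine Finset.sum_le_sum fun j hj => ?_
  rw [weightedAdj_apply hy]
  have := hx j
  split_ifs <;> simp [this]

end Objective

/-! ### Structure of strict local maximizers -/

section LocalMaximizer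

variable {V : Type*} [Fintype V] [DecidableEq V] {G : SimpleGraph V} [DecidableRel G.Adj]
  {s : ℕ} {α β : ℝ} {p : Space G}

theorem objective_add_smul_x (u : V → ℝ) (t : ℝ) :
    objective G α β (p + t • ofParts u 0) = objective G α β p +
      t * (2 * (u ⬝ᵥ weightedAdj G (yPart p) *ᵥ xPart p) + α * (u ⬝ᵥ xPart p)) +
      t ^ 2 * (u ⬝ᵥ weightedAdj G (yPart p) *ᵥ u + α / 2 * (u ⬝ᵥ u)) := by
  rw [objective_add_smul]
  simp [slope, curvature]

theorem objective_add_smul_y (v : Gᶜ.edgeSet → ℝ) (t : ℝ) :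
    objective G α β (p + t • ofParts 0 v) = objective G α β p +
      t * (xPart p ⬝ᵥ fakeAdj G v *ᵥ xPart p + β * (v ⬝ᵥ yPart p)) +
      t ^ 2 * (β / 2 * (v ⬝ᵥ v)) := by
  rw [objective_add_smul]
  simp [slope, curvature]

/-- A two-sided `y` direction would have positive curvature `β/2 ‖v‖²`. -/
theorem yPart_eq_zero_or_one (hβ : 0 < β)
    (hp : IsStrictLocalMaximizer (polytope G s) (objective G α β) p) (e : Gᶜ.edgeSet) :
    yPart p e = 0 ∨ yPart p e = 1 := by
  by_contra! hcon
  obtain ⟨v, hv, hv'⟩ := exists_y_mem_faceDirections hp.1 hcon.1 hcon.2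
  have h := (hp.of_mem_faceDirections hv' (objective_add_smul_y v)).2
  have h1 : 0 < v ⬝ᵥ v := lt_of_le_of_ne (Finset.sum_nonneg fun e _ => mul_self_nonneg _)
    (Ne.symm (by simpa using hv))
  have : 0 < β / 2 * (v ⬝ᵥ v) := by positivity
  linarith

/-- A local maximizer uses the whole budget of additional edges. -/
theorem sum_yPart_eq (hs : s ≤ Gᶜ.edgeFinset.card) (hβ : 0 < β)
    (hp : IsStrictLocalMaximizer (polytope G s) (objective G α β) p) :
    ∑ e, yPart p e = s := by
  obtain ⟨hx, hy, hsum⟩ := mem_polytope.1 hp.1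
  by_contra hne
  have hlt := lt_of_le_of_ne hsum hne
  by_cases hall : ∀ e, yPart p e = 1
  · have : (s : ℝ) ≤ Fintype.card Gᶜ.edgeSet := by
      rw [← SimpleGraph.edgeFinset_card]; exact_mod_cast hs
    simp only [hall, Finset.sum_const, Finset.card_univ, nsmul_eq_mul, mul_one] at hlt
    linarith
  push Not at hall
  obtain ⟨e, he⟩ := hall
  have he0 : yPart p e = 0 := (yPart_eq_zero_or_one hβ hp e).resolve_right he
  have hfeas : p + min 1 ((s : ℝ) - ∑ e, yPart p e) • ofParts 0 (Pi.single e 1) ∈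
      polytope G s := by
    set ε := min 1 ((s : ℝ) - ∑ e, yPart p e)
    have hε : 0 < ε := lt_min one_pos (by linarith)
    have hε1 : ε ≤ 1 := min_le_left _ _
    have hε2 : ε ≤ (s : ℝ) - ∑ e, yPart p e := min_le_right _ _
    rw [mem_polytope]
    simp only [xPart_add, yPart_add, xPart_smul, yPart_smul, xPart_ofParts, yPart_ofParts,
      smul_zero, Pi.add_apply, Pi.smul_apply, smul_eq_mul, Finset.sum_add_distrib,
      ← Finset.mul_sum, Finset.sum_pi_single', Finset.mem_univ, if_true]
    refine ⟨by simpa using hx, fun e' => ?_, by linarith⟩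
    rcases eq_or_ne e' e with rfl | hee
    · simp [he0, hε.le, hε1]
    · simp [hee, hy e']
  -- Switching on an unused edge has nonnegative slope, because `y e = 0` kills the `β` term, and
  -- positive curvature.
  have h := hp.first_second_order (convex_polytope s) (lt_min one_pos (by linarith)) hfeas
    (objective_add_smul_y _)
  have h0 : 0 ≤ xPart p ⬝ᵥ fakeAdj G (Pi.single e 1) *ᵥ xPart p := by
    refine Finset.sum_nonneg fun i _ => mul_nonneg (hx.1 i)
      (Finset.sum_nonneg fun j _ => mul_nonneg ?_ (hx.1 j))
    simp only [fakeAdj, Matrix.of_apply]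
    split_ifs
    · rw [Pi.single_apply]; split_ifs <;> norm_num
    · exact le_rfl
  simp only [single_dotProduct, he0, mul_zero, add_zero, Pi.single_eq_same,
    mul_one] at h
  have := h.2 (le_antisymm h.1 h0)
  linarith

/-- For nonadjacent `i`, `j` the exchange has no curvature from the matrix and `α > 0` from the
regularizer. -/
theorem adj_of_xPart_ne_zero (hα : 0 < α) (hβ : 0 < β)
    (hp : IsStrictLocalMaximizer (polytope G s) (objective G α β) p) {i j : V} (hij : i ≠ j)
    (hi : xPart p i ≠ 0) (hj : xPart p j ≠ 0) : (augmentedGraph G (yPart p)).Adj i j := by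
  classical
  by_contra hadj
  have hy := yPart_eq_zero_or_one hβ hp
  have h := (hp.of_mem_faceDirections (x_exchange_mem_faceDirections hp.1 hij hi hj)
    (objective_add_smul_x _)).2
  have hadj' : ¬ (augmentedGraph G (yPart p)).Adj j i := fun h => hadj h.symm
  simp [sub_dotProduct, mulVec_sub, weightedAdj_apply hy, hadj, hadj', hij, hij.symm] at h
  linarith

/-- The partial derivative at a support vertex is `2 (1 - x_i) + α x_i`; the exchange condition
equates these, and `α ≠ 2`. -/
theorem xPart_eq_of_ne_zero (hα : 0 < α) (hα2 : α < 2) (hβ : 0 < β)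
    (hp : IsStrictLocalMaximizer (polytope G s) (objective G α β) p) {i j : V}
    (hi : xPart p i ≠ 0) (hj : xPart p j ≠ 0) : xPart p i = xPart p j := by
  rcases eq_or_ne i j with rfl | hij
  · rfl
  have hy := yPart_eq_zero_or_one hβ hp
  have h := (hp.of_mem_faceDirections (x_exchange_mem_faceDirections hp.1 hij hi hj)
    (objective_add_smul_x _)).1
  simp only [sub_dotProduct, single_dotProduct, one_mul] at h
  rw [weightedAdj_mulVec_eq hy fun k hk hik => adj_of_xPart_ne_zero hα hβ hp hik hi hk,
    weightedAdj_mulVec_eq hy fun k hk hjk => adj_of_xPart_ne_zero hα hβ hp hjk hj hk] at h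
  have : (2 - α) * (xPart p i - xPart p j) = 0 := by linarith
  rcases mul_eq_zero.1 this with h | h <;> linarith

/-- A strict local maximizer is `(x^{(C)}, y)`, where `y` is a 0-1 vector with exactly `s` ones and
`C` is a maximal clique of `G(y)`. -/
theorem exists_maximal_clique (hs : s ≤ Gᶜ.edgeFinset.card) (hα : 0 < α) (hα2 : α < 2)
    (hβ : 0 < β) (hp : IsStrictLocalMaximizer (polytope G s) (objective G α β) p) :
    ∃ C : Finset V, C.Nonempty ∧ xPart p = charVec C ∧
      (∀ e, yPart p e = 0 ∨ yPart p e = 1) ∧ ∑ e, yPart p e = s ∧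
      Maximal (fun D : Finset V => (augmentedGraph G (yPart p)).IsClique (D : Set V)) C := by
  classical
  obtain ⟨⟨hx, hx1⟩, -⟩ := mem_polytope.1 hp.1
  have hy := yPart_eq_zero_or_one hβ hp
  set C := Finset.univ.filter fun i => xPart p i ≠ 0 with hC
  have hmem : ∀ i, i ∈ C ↔ xPart p i ≠ 0 := by simp [hC]
  have hsum : ∑ i ∈ C, xPart p i = 1 := by rw [hC, Finset.sum_filter_ne_zero, hx1]
  have hne : C.Nonempty := by
    rw [Finset.nonempty_iff_ne_empty]
    intro h
    simp [h] at hsum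
  refine ⟨C, hne, ?_, hy, sum_yPart_eq hs hβ hp, ?_, ?_⟩
  · ext i
    rw [charVec]
    split_ifs with hi
    · have : ∑ j ∈ C, xPart p j = C.card * xPart p i := by
        rw [Finset.sum_congr rfl fun j hj =>
          xPart_eq_of_ne_zero hα hα2 hβ hp ((hmem j).1 hj) ((hmem i).1 hi)]
        simp
      rw [hsum] at this
      have hcard : (0 : ℝ) < C.card := by exact_mod_cast hne.card_pos
      field_simp
      linarith
    · simpa [hmem] using hi
  · intro i hi j hj hij
    exact adj_of_xPart_ne_zero hα hβ hp hij ((hmem i).1 hi) ((hmem j).1 hj)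
  · intro D hD hCD v hv
    by_contra hvC
    obtain ⟨i, hi⟩ := hne
    have hvi : v ≠ i := by rintro rfl; exact hvC hi
    have hxi := lt_of_le_of_ne (hx i) ((hmem i).1 hi).symm
    have hxv : xPart p v = 0 := by simpa [hmem] using hvC
    -- Shifting mass from `i` to a vertex joined to all of `C` would have slope `(2 - α) x_i > 0`.
    have h := (hp.first_second_order (convex_polytope s) hxi
      (add_smul_single_sub_single_mem hp.1 hvi hxi.le le_rfl) (objective_add_smul_x _)).1
    simp only [sub_dotProduct, single_dotProduct, one_mul] at h
    rw [weightedAdj_mulVec_eq hy fun k hk hik => adj_of_xPart_ne_zero hα hβ hp hik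
      ((hmem i).1 hi) hk, weightedAdj_mulVec_eq hy fun k hk hvk =>
        hD hv (hCD ((hmem k).2 hk)) hvk, hxv] at h
    have : 0 < (2 - α) * xPart p i := mul_pos (by linarith) hxi
    linarith

end LocalMaximizer

/-! ### The clique face as a strictly complementary quadratic face -/

section Face

variable {V : Type*} [Fintype V] {G : SimpleGraph V} {C : Finset V}

variable (G C) in
/-- The directions of the face of the points `(x, y)` with `x` supported in `C` and `y` fixed. -/
def cliqueDirections : Submodule ℝ (Space G) where
  carrier := {u | yPart u = 0 ∧ (∀ i ∉ C, xPart u i = 0) ∧ ∑ i, xPart u i = 0}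
  zero_mem' := ⟨rfl, fun _ _ => rfl, Finset.sum_eq_zero fun _ _ => rfl⟩
  add_mem' := by
    rintro u v ⟨h1, h2, h3⟩ ⟨k1, k2, k3⟩
    refine ⟨by simp [h1, k1], fun i hi => by simp [h2 i hi, k2 i hi], ?_⟩
    simp [Finset.sum_add_distrib, h3, k3]
  smul_mem' := by
    rintro t u ⟨h1, h2, h3⟩
    refine ⟨by simp [h1], fun i hi => by simp [h2 i hi], ?_⟩
    simp [← Finset.mul_sum, h3]

theorem mem_cliqueDirections {u : Space G} : u ∈ cliqueDirections G C ↔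
    yPart u = 0 ∧ (∀ i ∉ C, xPart u i = 0) ∧ ∑ i, xPart u i = 0 := Iff.rfl

variable [DecidableEq V] [DecidableRel G.Adj] {s : ℕ} {α β : ℝ} {p : Space G}

theorem dotProduct_charVec {u : V → ℝ} (hu : ∀ i ∉ C, u i = 0) (hsum : ∑ i, u i = 0) :
    u ⬝ᵥ charVec C = 0 := by
  have : ∀ i, u i * charVec C i = u i * (1 / (C.card : ℝ)) := by
    intro i
    by_cases hi : i ∈ C
    · simp [charVec, hi]
    · simp [hu i hi]
  rw [dotProduct, Finset.sum_congr rfl fun i _ => this i, ← Finset.sum_mul, hsum, zero_mul]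

/-- On a clique the matrix is all-ones minus identity, and a zero-sum vector kills the all-ones
part. -/
theorem dotProduct_weightedAdj_mulVec {y : Gᶜ.edgeSet → ℝ} (hy : ∀ e, y e = 0 ∨ y e = 1)
    (hC : (augmentedGraph G y).IsClique (C : Set V)) {u x : V → ℝ} (hu : ∀ i ∉ C, u i = 0)
    (hsum : ∑ i, u i = 0) (hx : ∀ i ∉ C, x i = 0) :
    u ⬝ᵥ weightedAdj G y *ᵥ x = - (u ⬝ᵥ x) := by
  have : ∀ i, u i * (weightedAdj G y *ᵥ x) i = u i * ∑ j, x j - u i * x i := by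
    intro i
    by_cases hi : i ∈ C
    · rw [weightedAdj_mulVec_eq hy, mul_sub]
      intro j hj hij
      exact hC hi (by_contra fun h => hj (hx j h)) hij
    · simp [hu i hi]
  rw [dotProduct, Finset.sum_congr rfl fun i _ => this i, Finset.sum_sub_distrib,
    ← Finset.sum_mul, hsum, zero_mul, zero_sub, dotProduct]

theorem slope_eq_on_face (hy : ∀ e, yPart p e = 0 ∨ yPart p e = 1) (hx : xPart p = charVec C)
    (hC : (augmentedGraph G (yPart p)).IsClique (C : Set V)) {z u : Space G}
    (hz : z - p ∈ cliqueDirections G C) (hu : u ∈ cliqueDirections G C) :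
    slope G α β z u = -2 * (1 - α / 2) * inner ℝ (z - p) u := by
  obtain ⟨hz1, hz2, -⟩ := mem_cliqueDirections.1 hz
  obtain ⟨hu1, hu2, hu3⟩ := mem_cliqueDirections.1 hu
  rw [yPart_sub, sub_eq_zero] at hz1
  have hz2' : ∀ i ∉ C, xPart z i = 0 := fun i hi => by
    simpa [hx, charVec, hi] using hz2 i hi
  rw [slope, hz1, dotProduct_weightedAdj_mulVec hy hC hu2 hu3 hz2', hu1, inner_eq, xPart_sub,
    sub_dotProduct, hx, dotProduct_comm (charVec C), dotProduct_charVec hu2 hu3, hu1,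
    dotProduct_comm (xPart u)]
  simp
  ring

theorem objective_sub_eq (hy : ∀ e, yPart p e = 0 ∨ yPart p e = 1) (hx : xPart p = charVec C)
    (hC : (augmentedGraph G (yPart p)).IsClique (C : Set V)) {z : Space G}
    (hz : z - p ∈ cliqueDirections G C) :
    objective G α β p - objective G α β z = (1 - α / 2) * ‖z - p‖ ^ 2 := by
  have h := objective_add_smul G α β p (z - p) 1
  have h0 : slope G α β p (z - p) = 0 := by
    rw [slope_eq_on_face hy hx hC (by simp) hz]; simp
  obtain ⟨hz1, hz2, hz3⟩ := mem_cliqueDirections.1 hz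
  rw [one_smul, add_sub_cancel, h0, curvature, dotProduct_weightedAdj_mulVec hy hC hz2 hz3 hz2,
    hz1] at h
  rw [h, ← real_inner_self_eq_norm_sq, inner_eq, hz1]
  simp
  ring

/-- Strict complementarity: the linearized objective at the maximizer is maximal over the polytope
only on the face of the clique. -/
theorem slope_nonpos (hα : 0 < α) (hβ : 0 < β) (hp : p ∈ polytope G s)
    (hy : ∀ e, yPart p e = 0 ∨ yPart p e = 1)
    (hs : ∑ e, yPart p e = s) (hne : C.Nonempty) (hx : xPart p = charVec C)
    (hC : Maximal (fun D : Finset V => (augmentedGraph G (yPart p)).IsClique (D : Set V)) C)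
    {z : Space G} (hz : z ∈ polytope G s) :
    slope G α β p (z - p) ≤ 0 ∧ (slope G α β p (z - p) = 0 → z - p ∈ cliqueDirections G C) := by
  obtain ⟨⟨hz1, hz2⟩, hz3, hz4⟩ := mem_polytope.1 hz
  obtain ⟨⟨hp1, hp2⟩, -⟩ := mem_polytope.1 hp
  have hcard : (0 : ℝ) < C.card := by exact_mod_cast hne.card_pos
  set b := 1 / (C.card : ℝ) with hb
  have hbpos : 0 < b := by positivity
  have hin : ∀ i ∈ C, xPart p i = b := fun i hi => by simp [hx, charVec, hi, hb]
  have hout : ∀ i ∉ C, xPart p i = 0 := fun i hi => by simp [hx, charVec, hi]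
  have hmemC : ∀ i, xPart p i ≠ 0 → i ∈ C := fun i h => by_contra fun hi => h (hout i hi)
  -- Reduced gradient: the subtracted multiplier of `∑ x = 1` is the common value of the partial
  -- derivatives on `C`.
  set g : V → ℝ := fun i => 2 * (weightedAdj G (yPart p) *ᵥ xPart p) i + α * xPart p i -
    (2 - (2 - α) * b) with hg
  have hgin : ∀ i ∈ C, g i = 0 := by
    intro i hi
    simp only [hg]
    rw [weightedAdj_mulVec_eq hy fun j hj hij => hC.prop hi (hmemC j hj) hij, hp2, hin i hi]
    ring
  have hgout : ∀ i ∉ C, g i < 0 := by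
    intro i hi
    obtain ⟨k, hk, hik⟩ : ∃ k ∈ C, ¬ (augmentedGraph G (yPart p)).Adj i k := by
      by_contra! hcon
      refine hi (hC.le_of_ge (y := insert i C) ?_ (Finset.subset_insert i C)
        (Finset.mem_insert_self i C))
      simp only [Finset.coe_insert]
      exact hC.prop.insert fun k hk _ => hcon k hk
    have h := weightedAdj_mulVec_le hy hp1 hik
    rw [hp2, hin k hk] at h
    simp only [hg, hout i hi]
    have : 0 < α * b := by positivity
    linarith
  have hterm1 : ∀ i, (xPart z i - xPart p i) * g i ≤ 0 := by
    intro i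
    by_cases hi : i ∈ C
    · simp [hgin i hi]
    · rw [hout i hi, sub_zero]
      exact mul_nonpos_of_nonneg_of_nonpos (hz1 i) (hgout i hi).le
  have hT1 : 2 * (xPart (z - p) ⬝ᵥ weightedAdj G (yPart p) *ᵥ xPart p) +
      α * (xPart (z - p) ⬝ᵥ xPart p) = ∑ i, (xPart z i - xPart p i) * g i := by
    have h0 : ∑ i, (xPart z i - xPart p i) * (2 - (2 - α) * b) = 0 := by
      rw [← Finset.sum_mul, Finset.sum_sub_distrib, hz2, hp2]; ring
    rw [← add_zero (∑ i, (xPart z i - xPart p i) * g i), ← h0, ← Finset.sum_add_distrib,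
      dotProduct, dotProduct, Finset.mul_sum, Finset.mul_sum, ← Finset.sum_add_distrib]
    refine Finset.sum_congr rfl fun i _ => ?_
    simp only [hg, xPart_sub, Pi.sub_apply]
    ring
  -- Only pairs inside `C` count, and there each non-edge of `G` has `y = 1` at `p`, which can only
  -- decrease.
  have hT2 : xPart p ⬝ᵥ fakeAdj G (yPart (z - p)) *ᵥ xPart p ≤ 0 := by
    refine Finset.sum_nonpos fun i _ => ?_
    by_cases hi : i ∈ C
    · refine mul_nonpos_of_nonneg_of_nonpos (hp1 i) (Finset.sum_nonpos fun j _ => ?_)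
      by_cases hj : j ∈ C
      · refine mul_nonpos_of_nonpos_of_nonneg ?_ (hp1 j)
        simp only [fakeAdj, Matrix.of_apply]
        split_ifs with h
        · have hij : i ≠ j := ((SimpleGraph.mem_edgeSet _).1 h).ne
          have hadj := hC.prop hi hj hij
          have h1 : yPart p ⟨s(i, j), h⟩ = 1 := by
            rcases hadj with hadj | hadj
            · exact absurd hadj ((SimpleGraph.compl_adj _ _ _).1 ((SimpleGraph.mem_edgeSet _).1 h)).2
            · exact (SimpleGraph.fromEdgeSet_adj _ |>.1 hadj).1.2
          rw [yPart_sub, Pi.sub_apply, h1]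
          linarith [(hz3 ⟨s(i, j), h⟩).2]
        · exact le_rfl
      · simp [hout j hj]
    · simp [hout i hi]
  have hterm3 : ∀ e, (yPart z e - yPart p e) * yPart p e ≤ 0 := by
    intro e
    rcases hy e with h | h
    · simp [h]
    · rw [h]; linarith [(hz3 e).2]
  have hT3 : yPart (z - p) ⬝ᵥ yPart p = ∑ e, (yPart z e - yPart p e) * yPart p e := rfl
  have h1 := Finset.sum_nonpos fun i (_ : i ∈ Finset.univ) => hterm1 i
  have h3 := Finset.sum_nonpos fun e (_ : e ∈ Finset.univ) => hterm3 e
  have h3' := mul_nonpos_of_nonneg_of_nonpos hβ.le h3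
  rw [← hT1] at h1
  rw [← hT3] at h3 h3'
  refine ⟨by rw [slope]; linarith, fun h => ?_⟩
  rw [slope] at h
  have e1 : ∑ i, (xPart z i - xPart p i) * g i = 0 := by rw [← hT1]; linarith
  have e3 : ∑ e, (yPart z e - yPart p e) * yPart p e = 0 := by
    rw [← hT3]
    have : β * (yPart (z - p) ⬝ᵥ yPart p) = 0 := by linarith
    exact (mul_eq_zero.1 this).resolve_left hβ.ne'
  rw [Finset.sum_eq_zero_iff_of_nonpos fun i _ => hterm1 i] at e1
  rw [Finset.sum_eq_zero_iff_of_nonpos fun i _ => hterm3 i] at e3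
  have hle : ∀ e, yPart p e ≤ yPart z e := by
    intro e
    rcases hy e with h0 | h0
    · rw [h0]; exact (hz3 e).1
    · have := e3 e (Finset.mem_univ e)
      rw [h0] at this ⊢
      linarith
  -- As `p` exhausts the budget, no room is left to exceed its `y` component.
  have heq := (Finset.sum_eq_sum_iff_of_le fun e (_ : e ∈ Finset.univ) => hle e).1
    (le_antisymm (Finset.sum_le_sum fun e _ => hle e) (hs ▸ hz4))
  refine mem_cliqueDirections.2 ⟨?_, fun i hi => ?_, ?_⟩
  · ext e
    simp [heq e (Finset.mem_univ e)]
  · exact (mul_eq_zero.1 (e1 i (Finset.mem_univ i))).resolve_right (hgout i hi).ne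
  · simp [Finset.sum_sub_distrib, hz2, hp2]

/-- The radius is the clique weight `1 / |C|`: a perturbation in `M` of at most this norm keeps `x`
nonnegative. -/
theorem exists_isQuadraticFace (hα : 0 < α) (hα2 : α < 2) (hβ : 0 < β) (hp : p ∈ polytope G s)
    (hy : ∀ e, yPart p e = 0 ∨ yPart p e = 1)
    (hs : ∑ e, yPart p e = s) (hne : C.Nonempty) (hx : xPart p = charVec C)
    (hC : Maximal (fun D : Finset V => (augmentedGraph G (yPart p)).IsClique (D : Set V)) C) :
    ∃ κ r m, IsQuadraticFace (convex_polytope s) (objective G α β) p (cliqueDirections G C)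
      κ r m := by
  have hslope := fun z (hz : z ∈ polytope G s) => slope_nonpos hα hβ hp hy hs hne hx hC hz
  have hcard : (0 : ℝ) < C.card := by exact_mod_cast hne.card_pos
  obtain ⟨m, hm, hmargin⟩ := exists_face_margin (finite_extremePoints (G := G) s)
    (convexHull_extremePoints s) (convex_polytope s) (p := p)
    (g := gradient (objective G α β) p)
    fun v hv => by rw [inner_gradient_objective]; exact (hslope v hv).1
  refine ⟨1 - α / 2, 1 / C.card, m, hp, by linarith, by positivity, hm, ?_, ?_, ?_, ?_, ?_⟩
  · intro u hu hur
    obtain ⟨hu1, hu2, hu3⟩ := mem_cliqueDirections.1 hu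
    obtain ⟨⟨hp1, hp2⟩, hp3⟩ := mem_polytope.1 hp
    rw [mem_polytope]
    simp only [xPart_add, yPart_add, hu1, add_zero]
    refine ⟨⟨fun i => ?_, ?_⟩, hp3⟩
    · by_cases hi : i ∈ C
      · have := (abs_le.1 ((abs_xPart_le u i).trans hur)).1
        simp only [hx, charVec, hi, if_true, Pi.add_apply]
        linarith
      · simpa [hu2 i hi] using hp1 i
    · simp [Finset.sum_add_distrib, hu3, hp2]
  · exact fun z _ hzM => objective_sub_eq hy hx hC.prop hzM
  · intro z _ hzM u hu
    rw [inner_gradient_objective]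
    exact slope_eq_on_face hy hx hC.prop hzM hu
  · intro z hz
    rw [inner_gradient_objective]
    exact (hslope z hz).1
  · intro v hv hvM
    refine hmargin v hv fun h => hvM ((hslope v hv).2 ?_)
    rwa [inner_gradient_objective] at h

end Face

end DefectiveClique

theorem mainTheorem7 {V : Type*} [Fintype V] [DecidableEq V]
    (G : SimpleGraph V) [DecidableRel G.Adj]
    (s : ℕ) (hs : s ≤ Gᶜ.edgeFinset.card)
    (α β : ℝ) (hα : α ∈ Set.Ioo (0 : ℝ) 2) (hβ : 0 < β)
    (p : DefectiveClique.Space G)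
    (hp : FDFW.IsStrictLocalMaximizer (DefectiveClique.polytope G s)
      (DefectiveClique.objective G α β) p) :
    ∃ C : Finset V, C.Nonempty ∧
      DefectiveClique.xPart p = DefectiveClique.charVec C ∧
      DefectiveClique.yPart p ∈ DefectiveClique.fakeEdges G s ∧
      Maximal (fun D : Finset V =>
        (DefectiveClique.augmentedGraph G (DefectiveClique.yPart p)).IsClique (D : Set V)) C ∧
      ∀ c : ℝ, 0 < c → ∃ U ∈ 𝓝 p,
        ∀ (z d : ℕ → DefectiveClique.Space G) (a : ℕ → ℝ),
          FDFW.IsRun (DefectiveClique.polytope G s) (DefectiveClique.objective G α β) z d a →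
          FDFW.StepsizeLowerBound (DefectiveClique.polytope G s)
            (DefectiveClique.objective G α β) c z d a →
          ∀ kbar : ℕ, IsLeast {k | z k ∈ U} kbar →
            (Monotone (fun k => DefectiveClique.objective G α β (z k)) →
              ∀ k, kbar + FDFW.faceDim (DefectiveClique.polytope G s) (z kbar) ≤ k →
                Function.support (DefectiveClique.xPart (z k)) = (C : Set V) ∧
                DefectiveClique.yPart (z k) = DefectiveClique.yPart p) ∧
            (∀ ρ : ℝ, 0 < ρ →
              FDFW.SufficientIncrease (DefectiveClique.polytope G s)
                (DefectiveClique.objective G α β) c ρ z d a →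
              Filter.Tendsto z Filter.atTop (𝓝 p)) := by
  classical
  obtain ⟨C, hne, hx, hy, hsum, hC⟩ :=
    DefectiveClique.exists_maximal_clique hs hα.1 hα.2 hβ hp
  refine ⟨C, hne, hx, ⟨hy, hsum.le⟩, hC, fun c hc => ?_⟩
  obtain ⟨κ, r, m, H⟩ :=
    DefectiveClique.exists_isQuadraticFace hα.1 hα.2 hβ hp.1 hy hsum hne hx hC
  have hcard : (0 : ℝ) < C.card := by exact_mod_cast hne.card_pos
  obtain ⟨U, hU, hconv⟩ := H.local_convergence (DefectiveClique.isCompact_polytope s)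
    (DefectiveClique.continuous_gradient_objective G α β).continuousAt hc
    -- Half the clique weight, so the coordinates in `C` stay nonzero.
    (ε := 1 / (2 * C.card)) (by positivity)
  refine ⟨U, hU, fun z d a hrun hlow kbar hkbar => ?_⟩
  obtain ⟨h1, h2⟩ := hconv z d a hrun hlow kbar hkbar.1
  refine ⟨fun hmono k hk => ?_, h2⟩
  obtain ⟨hM, hnorm⟩ := h1 hmono k hk
  obtain ⟨hM1, hM2, -⟩ := DefectiveClique.mem_cliqueDirections.1 hM
  refine ⟨?_, by simpa [sub_eq_zero] using hM1⟩
  ext i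
  rw [Function.mem_support, Finset.mem_coe]
  by_cases hi : i ∈ C
  · refine iff_of_true (fun h0 => ?_) hi
    have hle := (abs_le.1 ((DefectiveClique.abs_xPart_le _ i).trans hnorm)).1
    rw [DefectiveClique.xPart_sub, Pi.sub_apply, h0, hx, DefectiveClique.charVec, if_pos hi] at hle
    have : 1 / (2 * (C.card : ℝ)) < 1 / C.card := by
      apply one_div_lt_one_div_of_lt hcard; linarith
    linarith
  · refine iff_of_false (fun h0 => h0 ?_) hi
    simpa [hx, DefectiveClique.charVec, hi] using hM2 i hi
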